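/- Let $f=(f_1,f_2)$ be a flux on (a subset of) $\mathbb R^2$ and $d\in\mathbb R^2$ a state satisfying **(GL)**: there is $r>0$ such that $f$ is $C^4$ on $B_r(d)$, the matrix $f'(d)$ has two distinct real eigenvalues, and both characteristic fields are genuinely nonlinear at $d$. For $u$ near $d$ let $\lambda_1(u)<\lambda_2(u)$ be the eigenvalues of $f'(u)$ and $r_i(u)$ the unit eigenvectors, oriented so that $\nabla\lambda_i(u)\cdot r_i(u)>0$. Let $(\eta,q)$ be a $C^3$ entropy/entropy flux pair on an open neighborhood $W$ of $d$, i.e. $\nabla q=\nabla\eta\, f'$, with $\nabla^2\eta$ positive definite on $W$, and put $$\eta(a|b)=\eta(a)-\eta(b)-\nabla\eta(b)(a-b),\qquad q(a;b)=q(a)-q(b)-\nabla\eta(b)(f(a)-f(b)).$$ For $0<T\le\infty$ and $\epsilon>0$ let $\mathcal S^{d,\epsilon}_{\rm weak}$ be the set of $u\in L^\infty((0,T)\times\mathbb R;B_\epsilon(d))$ that solve $u_t+[f(u)]_x=0$ and $[\eta(u)]_t+[q(u)]_x\le0$ in $\mathcal D'((0,T)\times\mathbb R)$ and have the Strong Trace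 Property: for every Lipschitz curve $x=h(t)$ there are bounded functions $u_\pm(t)=u(t,h(t)\pm)$ with $$\lim_{n\to\infty}\int_0^{T'}\operatorname*{ess\,sup}_{y\in(0,1/n)}|u(t,h(t)\pm y)-u_\pm(t)|\,dt=0\quad\text{for all finite } T'<T .$$ Then there are constants $K,C_2,\epsilon>0$, depending only on $f,d,\eta,q,W$, such that the following holds for every $T\in(0,\infty]$ and every $u\in\mathcal S^{d,\epsilon}_{\rm weak}$. The distribution $\mu_u=\partial_t\eta(u)+\partial_xq(u)$ is a non-positive measure on $(0,T)\times\mathbb R$ which, extended by zero, is locally finite on $\mathbb R\times\mathbb R$. Moreover, let $i\in\{1,2\}$, $s_0>0$, and let $u_L,u_R$ satisfy $|u_L-d|+|u_R-d|\le\epsilon$ and $u_R=R(s_0)$, where $R$ is the $i$-th rarefaction curve at $u_L$, i.e. $R'=r_i(R)$ on $[0,s_0]$, $R(0)=u_L$. Let $v_L=\lambda_i(u_L)$, $v_R=\lambda_i(u_R)$, let $y(t,x)$ be the rarefaction solution of the scalar Riemann problem $y_t+[f_i(y)]_x=0$, $f_i(s)=\int_0^s\lambda_i(R(\rho))\,d\rho$,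 with data $y=0$ for $x<0$ and $y=s_0$ for $x>0$ (that is, $y=0$ for $x/t<v_L$, $y=(f_i')^{-1}(x/t)$ for $v_L\le x/t\le v_R$, $y=s_0$ for $x/t>v_R$), let $\overline u(t,x)=R(y(t,x))$ be the rarefaction wave, and let $$\overline\sigma=|v_L-v_R|+\sup_{t>0,\,x\in\mathbb R}|u_L-\overline u(t,x)|.$$ Let $a_1,a_2>0$ satisfy $$1+\tfrac{C_2s_0}{2}\le\tfrac{a_1}{a_2}\le1+2C_2s_0\ \text{ if } i=1,\qquad 1-2C_2s_0\le\tfrac{a_1}{a_2}\le1-\tfrac{C_2s_0}{2}\ \text{ if } i=2 .$$ Then for every $v$ between $v_L$ and $v_R$ (endpoints included) and every $t\in(0,T)$, $$\int_0^t\Bigl\{a_2\bigl(q(u(\tau,v\tau+);u_R)-v\,\eta(u(\tau,v\tau+)|u_R)\bigr)-a_1\bigl(q(u(\tau,v\tau-);u_L)-v\,\eta(u(\tau,v\tau-)|u_L)\bigr)\Bigr\}\,d\tau\le a_2\bigl(K\overline\sigma^2t+K\overline\sigma\,|\mu_u|(\mathcal C_{v_L,v_R})\bigr),$$ where $\mathcal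 C_{v_L,v_R}=\{(\tau,x)\mid 0\le\tau\le t,\ v_L\tau\le x\le v_R\tau\}$ is the rarefaction fan. -/

import Mathlib

open Set Filter Topology MeasureTheory
open scoped ENNReal ContDiff

noncomputable section

namespace RareDissipation

/-- The states `u = (u₁, u₂) ∈ ℝ²`, with the Euclidean norm. -/
abbrev State : Type := EuclideanSpace ℝ (Fin 2)

/-! ### The flux and its characteristic fields -/

/-- The set of real eigenvalues of the Jacobian `f'(u)`. -/
def eigenvalueSet (f : State → State) (u : State) : Set ℝ :=
  {l : ℝ | Module.End.HasEigenvalue (fderiv ℝ f u : State →ₗ[ℝ] State) l}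

/-- `f'(u)` has two distinct real eigenvalues. -/
def StrictlyHyperbolicAt (f : State → State) (u : State) : Prop :=
  ∃ l₁ ∈ eigenvalueSet f u, ∃ l₂ ∈ eigenvalueSet f u, l₁ < l₂

/-- The characteristic speeds `λ₁(u) < λ₂(u)`: the smallest and the largest eigenvalue of `f'(u)`.
The index `0 : Fin 2` is the first family, `1 : Fin 2` the second one. -/
def charSpeed (f : State → State) (i : Fin 2) (u : State) : ℝ :=
  if i = 0 then sInf (eigenvalueSet f u) else sSup (eigenvalueSet f u)

/-- The `i`-th characteristic field is genuinely nonlinear at `u`: `∇λᵢ(u) · v ≠ 0` for every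
eigenvector `v` of `f'(u)` belonging to `λᵢ(u)`. -/
def GenuinelyNonlinearAt (f : State → State) (i : Fin 2) (u : State) : Prop :=
  ∀ v : State, v ≠ 0 → fderiv ℝ f u v = charSpeed f i u • v → fderiv ℝ (charSpeed f i) u v ≠ 0

/-- Condition (GL) at the state `d`. -/
def SatisfiesGL (f : State → State) (d : State) : Prop :=
  ∃ r > 0, ContDiffOn ℝ 4 f (Metric.ball d r) ∧ StrictlyHyperbolicAt f d ∧
    ∀ i : Fin 2, GenuinelyNonlinearAt f i d

/-- `v = rᵢ(u)`: the unit eigenvector of `f'(u)` for `λᵢ(u)`, oriented so that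
`∇λᵢ(u) · rᵢ(u) > 0`. -/
def IsCharVector (f : State → State) (i : Fin 2) (u v : State) : Prop :=
  ‖v‖ = 1 ∧ fderiv ℝ f u v = charSpeed f i u • v ∧ 0 < fderiv ℝ (charSpeed f i) u v

/-! ### Entropies and relative quantities -/

/-- `(η, q)` is a `C³` entropy/entropy flux pair on `W`, `∇q = ∇η f'`, and `η` is strictly convex
in the sense that its Hessian is positive definite. -/
structure IsConvexEntropyPair (f : State → State) (W : Set State) (η q : State → ℝ) : Prop where
  contDiffOn_entropy : ContDiffOn ℝ 3 η W
  contDiffOn_flux : ContDiffOn ℝ 3 q W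
  compatible : ∀ u ∈ W, fderiv ℝ q u = (fderiv ℝ η u).comp (fderiv ℝ f u)
  hessian_pos : ∀ u ∈ W, ∀ ξ : State, ξ ≠ 0 → 0 < fderiv ℝ (fderiv ℝ η) u ξ ξ

/-- The relative entropy `η(a|b)`. -/
def relEntropy (η : State → ℝ) (a b : State) : ℝ :=
  η a - η b - fderiv ℝ η b (a - b)

/-- The relative entropy flux `q(a;b)`. -/
def relFlux (f : State → State) (η q : State → ℝ) (a b : State) : ℝ :=
  q a - q b - fderiv ℝ η b (f a - f b)

/-! ### Entropy solutions on `(0,T) × ℝ` with strong traces, `T ≤ ∞`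

Points of space-time are pairs `(t, x)`. -/

/-- The open time interval `(0,T)`, where `T = ⊤` is allowed. -/
def timeInterval (T : EReal) : Set ℝ := {t : ℝ | 0 < t ∧ (t : EReal) < T}

/-- The strip `(0,T) × ℝ`. -/
def strip (T : EReal) : Set (ℝ × ℝ) := {p | p.1 ∈ timeInterval T}

/-- Test functions: elements of `C_c^∞((0,T) × ℝ)`. -/
structure IsTest (T : EReal) (φ : ℝ × ℝ → ℝ) : Prop where
  smooth : ContDiff ℝ ∞ φ
  compact : HasCompactSupport φ
  support_subset : tsupport φ ⊆ strip T

/-- The partial derivative `φ_t`. -/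
def dt (φ : ℝ × ℝ → ℝ) (p : ℝ × ℝ) : ℝ := fderiv ℝ φ p (1, 0)

/-- The partial derivative `φ_x`. -/
def dx (φ : ℝ × ℝ → ℝ) (p : ℝ × ℝ) : ℝ := fderiv ℝ φ p (0, 1)

/-- `w` is the strong trace of `u` from the right along the curve `x = h(t)`. -/
structure IsRightTrace (T : EReal) (u : ℝ × ℝ → State) (h : ℝ → ℝ) (w : ℝ → State) : Prop where
  memLp : MemLp w ⊤ (volume.restrict (timeInterval T))
  tendsto : ∀ T' : ℝ, (T' : EReal) < T →
    Tendsto (fun n : ℕ => ∫⁻ t in Ioo 0 T',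
        essSup (fun y : ℝ => ‖u (t, h t + y) - w t‖ₑ)
          (volume.restrict (Ioo (0 : ℝ) (1 / ((n : ℝ) + 1)))))
      atTop (𝓝 0)

/-- `w` is the strong trace of `u` from the left along the curve `x = h(t)`. -/
structure IsLeftTrace (T : EReal) (u : ℝ × ℝ → State) (h : ℝ → ℝ) (w : ℝ → State) : Prop where
  memLp : MemLp w ⊤ (volume.restrict (timeInterval T))
  tendsto : ∀ T' : ℝ, (T' : EReal) < T →
    Tendsto (fun n : ℕ => ∫⁻ t in Ioo 0 T',
        essSup (fun y : ℝ => ‖u (t, h t + y) - w t‖ₑ)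
          (volume.restrict (Ioo (-(1 / ((n : ℝ) + 1))) (0 : ℝ))))
      atTop (𝓝 0)

/-- The Strong Trace Property: traces exist on both sides of every Lipschitz curve. -/
def StrongTraceProperty (T : EReal) (u : ℝ × ℝ → State) : Prop :=
  ∀ h : ℝ → ℝ, (∃ L, LipschitzWith L h) →
    (∃ w, IsRightTrace T u h w) ∧ (∃ w, IsLeftTrace T u h w)

/-- The class of small (possibly non-BV) entropy solutions around `d`: measurable `u` with values in
the ball `B_ε(d)`, solving `u_t + f(u)_x = 0` and `η(u)_t + q(u)_x ≤ 0` in the sense of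
distributions on `(0,T) × ℝ`, and having the Strong Trace Property. -/
structure IsSmallEntropySolution (f : State → State) (η q : State → ℝ) (d : State) (ε : ℝ)
    (T : EReal) (u : ℝ × ℝ → State) : Prop where
  measurable : AEStronglyMeasurable u (volume.restrict (strip T))
  mem_ball : ∀ᵐ p ∂(volume.restrict (strip T)), u p ∈ Metric.ball d ε
  weak : ∀ φ, IsTest T φ → ∫ p in strip T, (dt φ p • u p + dx φ p • f (u p)) = 0
  entropic : ∀ φ, IsTest T φ → (∀ p, 0 ≤ φ p) →
    0 ≤ ∫ p in strip T, (dt φ p * η (u p) + dx φ p * q (u p))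
  strongTrace : StrongTraceProperty T u

/-- `m = |μ_u| = -μ_u`, where `μ_u = ∂ₜ η(u) + ∂ₓ q(u)` is the non-positive entropy dissipation
measure on `(0,T) × ℝ`, extended by zero: `∫ φ dm = -⟨μ_u, φ⟩` for all test functions `φ`.
At most one measure has these properties. -/
structure IsDissipationMeasure (η q : State → ℝ) (T : EReal) (u : ℝ × ℝ → State)
    (m : Measure (ℝ × ℝ)) : Prop where
  locallyFinite : IsLocallyFiniteMeasure m
  compl_null : m (strip T)ᶜ = 0
  integral_test : ∀ φ, IsTest T φ →
    ∫ p, φ p ∂m = ∫ p in strip T, (dt φ p * η (u p) + dx φ p * q (u p))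

/-! ### Rarefaction waves -/

/-- `R` is, on `[0,s₀]`, the `i`-th rarefaction curve at `uL`:
`R' = rᵢ(R)`, `R(0) = uL`. -/
def IsRarefactionCurve (f : State → State) (i : Fin 2) (uL : State) (s₀ : ℝ) (R : ℝ → State) :
    Prop :=
  R 0 = uL ∧ ∀ s ∈ Icc 0 s₀, ∃ v, IsCharVector f i (R s) v ∧ HasDerivWithinAt R v (Icc 0 s₀) s

/-- The rarefaction solution `y(t,x)` of the scalar problem `y_t + fᵢ(y)_x = 0` with Riemann data
`0`, `s₀`, where `fᵢ(s) = ∫₀ˢ λᵢ(R(r)) dr`, so that `fᵢ' = λᵢ ∘ R`. -/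
def scalarRarefaction (f : State → State) (i : Fin 2) (R : ℝ → State) (s₀ t x : ℝ) : ℝ :=
  if x / t < charSpeed f i (R 0) then 0
  else if x / t ≤ charSpeed f i (R s₀) then
    Function.invFunOn (fun s => charSpeed f i (R s)) (Icc 0 s₀) (x / t)
  else s₀

/-- The rarefaction wave `ū(t,x) = R(y(t,x))`. -/
def rarefactionWave (f : State → State) (i : Fin 2) (R : ℝ → State) (s₀ t x : ℝ) : State :=
  R (scalarRarefaction f i R s₀ t x)

/-- `σ̄ = |v_L - v_R| + sup_{t>0, x} |u_L - ū(t,x)|`, with `v_L = λᵢ(u_L)`, `v_R = λᵢ(u_R)`. -/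
def sigmaBar (f : State → State) (i : Fin 2) (uL uR : State) (R : ℝ → State) (s₀ : ℝ) : ℝ :=
  |charSpeed f i uL - charSpeed f i uR| +
    ⨆ p : Ioi (0 : ℝ) × ℝ, ‖uL - rarefactionWave f i R s₀ p.1 p.2‖

/-- The rarefaction fan `{(τ,x) | 0 ≤ τ ≤ t, v_L τ ≤ x ≤ v_R τ}`. -/
def fan (vL vR t : ℝ) : Set (ℝ × ℝ) :=
  {p | 0 ≤ p.1 ∧ p.1 ≤ t ∧ vL * p.1 ≤ p.2 ∧ p.2 ≤ vR * p.1}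

/-- The condition on the weights: `1 + C₂s₀/2 ≤ a₁/a₂ ≤ 1 + 2C₂s₀` for the first family and
`1 - 2C₂s₀ ≤ a₁/a₂ ≤ 1 - C₂s₀/2` for the second one. -/
def AdmissibleWeights (i : Fin 2) (C₂ s₀ a₁ a₂ : ℝ) : Prop :=
  if i = 0 then 1 + C₂ * s₀ / 2 ≤ a₁ / a₂ ∧ a₁ / a₂ ≤ 1 + 2 * C₂ * s₀
  else 1 - 2 * C₂ * s₀ ≤ a₁ / a₂ ∧ a₁ / a₂ ≤ 1 - C₂ * s₀ / 2

end RareDissipation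

end

/-!
Fix a line `x = v t` in the rarefaction fan and write
`F(a;b) = q(a;b) - v η(a|b)` (`relSpeedFlux`) for the relative entropy flux through it. Two facts
give the estimate.

*Across the line.* For a constant state `b` the pair `η(·|b), q(·;b)` differs from `η, q` by an
affine function of the conserved quantity and its flux (`relative_entropic`), so it satisfies the
same entropy inequality. Testing with functions that concentrate on the line gives
`∫ F(u₊;u_R) ≤ ∫ F(u₋;u_R)` for the strong traces (`flux_trace_le`). Hence the left-hand side of the
claim is at most `a₂ ∫ P(u₋)`, where `P(w) = F(w;u_R) - (a₁/a₂) F(w;u_L)` involves one state only.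

*One state.* `P(w) ≤ C s₀²` for every `w` near `d` (`exists_pointwise_bound`). With
`p = (∇η(u_R) - ∇η(u_L))/s₀` and `κ = (1 - a₁/a₂)/s₀`, the Hessian of `P` at `x` is `s₀` times
`κ (∇²η(x)(z, (f'(x)-v)z) + (∇η(x)-∇η(u_L)) f''(x)(z,z)) - p f''(x)(z,z)`. Near `d` the covector `p`
is close to the left eigenvector `∇²η rᵢ`. In the direction `rᵢ` the last term is negative by
genuine nonlinearity (`left_eigenvector_second_deriv`); the other characteristic direction is
controlled by the first term once `C₂` is large, the sign of `κ` being chosen according to the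
family (`exists_weight`). So `P` is concave and lies below its tangent at `u_L`. Its value there is
`F(u_L;u_R) = O(s₀²)`, and its gradient is `-(∇η(u_R)-∇η(u_L))(f'(u_L)-v) = O(s₀²)`, because `∇η`
changes along the rarefaction curve by left eigenvectors of `f' - λᵢ`
(`LocalBounds.relSpeedFlux_sub_le`). Finally `s₀` is bounded by a multiple of `|v_L - v_R|`, since a
rarefaction curve with endpoints near `d` stays near `d` (`rarefactionCurve_local`).

The dissipation measure comes from extending the nonnegative functional `-∂ₜη(u) - ∂ₓq(u)` from
test functions to `C_c` and applying the Riesz–Markov–Kakutani theorem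
(`exists_measure_of_nonneg_functional`). Its mass stays bounded up to the boundary of the strip,
because the cut-offs in time have bounded variation (`exists_dissipation_measure`). The dissipation
in the fan is not needed to bound the left-hand side; that term only enlarges the right-hand side.
-/

namespace RareDissipation

/-! ### Characteristic speeds of a planar flux -/

/-- The entry `(j,k)` of the matrix of `A` in the standard basis of `ℝ²`. -/
noncomputable def entry (A : State →L[ℝ] State) (j k : Fin 2) : ℝ := A (EuclideanSpace.single k 1) j

/-- The trace of an endomorphism of `ℝ²`. -/
noncomputable def tr (A : State →L[ℝ] State) : ℝ := entry A 0 0 + entry A 1 1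

/-- The determinant of an endomorphism of `ℝ²`. -/
noncomputable def det (A : State →L[ℝ] State) : ℝ :=
  entry A 0 0 * entry A 1 1 - entry A 0 1 * entry A 1 0

/-- The discriminant of the characteristic polynomial `l² - (tr A) l + det A`. -/
noncomputable def disc (A : State →L[ℝ] State) : ℝ := tr A ^ 2 - 4 * det A

lemma apply_coord (A : State →L[ℝ] State) (x : State) (j : Fin 2) :
    A x j = entry A j 0 * x 0 + entry A j 1 * x 1 := by
  have hx : x = x 0 • EuclideanSpace.single (0 : Fin 2) (1 : ℝ)
      + x 1 • EuclideanSpace.single (1 : Fin 2) (1 : ℝ) := by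
    ext k; fin_cases k <;> simp
  conv_lhs => rw [hx]
  simp only [map_add, map_smul, PiLp.add_apply, PiLp.smul_apply, smul_eq_mul, entry]
  ring

lemma exists_eigenvector_iff (A : State →L[ℝ] State) (l : ℝ) :
    (∃ x : State, x ≠ 0 ∧ A x = l • x) ↔ l ^ 2 - tr A * l + det A = 0 := by
  constructor
  · rintro ⟨x, hx, h⟩
    have h0 := congrArg (fun y : State => y 0) h
    have h1 := congrArg (fun y : State => y 1) h
    simp only [apply_coord, PiLp.smul_apply, smul_eq_mul] at h0 h1
    by_contra hne
    apply hx
    have e0 : (l ^ 2 - tr A * l + det A) * x 0 = 0 := by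
      unfold tr det
      linear_combination (entry A 1 1 - l) * h0 - entry A 0 1 * h1
    have e1 : (l ^ 2 - tr A * l + det A) * x 1 = 0 := by
      unfold tr det
      linear_combination (entry A 0 0 - l) * h1 - entry A 1 0 * h0
    ext k
    fin_cases k
    · simpa [hne] using e0
    · simpa [hne] using e1
  · intro h
    unfold tr det at h
    -- the columns of the adjugate of `A - l` are eigenvectors, unless they vanish and `A = l`
    by_cases hb : entry A 0 1 = 0 ∧ l - entry A 0 0 = 0
    · by_cases hc : l - entry A 1 1 = 0 ∧ entry A 1 0 = 0
      · refine ⟨!₂[1, 0], fun h0 => ?_, ?_⟩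
        · simpa using congrArg (fun y : State => y 0) h0
        · ext k
          fin_cases k <;> simp [apply_coord] <;> linarith [hb.2, hc.2]
      · refine ⟨!₂[l - entry A 1 1, entry A 1 0], fun h0 => hc ⟨?_, ?_⟩, ?_⟩
        · simpa using congrArg (fun y : State => y 0) h0
        · simpa using congrArg (fun y : State => y 1) h0
        · ext k
          fin_cases k
          · simp [apply_coord]; linear_combination -h
          · simp [apply_coord]; ring
    · refine ⟨!₂[entry A 0 1, l - entry A 0 0], fun h0 => hb ⟨?_, ?_⟩, ?_⟩
      · simpa using congrArg (fun y : State => y 0) h0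
      · simpa using congrArg (fun y : State => y 1) h0
      · ext k
        fin_cases k
        · simp [apply_coord]; ring
        · simp [apply_coord]; linear_combination -h

lemma mem_eigenvalueSet (f : State → State) (u : State) (l : ℝ) :
    l ∈ eigenvalueSet f u ↔ l ^ 2 - tr (fderiv ℝ f u) * l + det (fderiv ℝ f u) = 0 := by
  rw [← exists_eigenvector_iff]
  constructor
  · intro h
    obtain ⟨x, hx⟩ := Module.End.HasEigenvalue.exists_hasEigenvector h
    exact ⟨x, hx.2, by simpa using hx.apply_eq_smul⟩
  · rintro ⟨x, hx, h⟩
    exact Module.End.hasEigenvalue_of_hasEigenvector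
      (x := x) ⟨Module.End.mem_eigenspace_iff.2 (by simpa using h), hx⟩

lemma disc_pos_of_strictlyHyperbolicAt {f : State → State} {u : State}
    (h : StrictlyHyperbolicAt f u) : 0 < disc (fderiv ℝ f u) := by
  obtain ⟨l₁, h₁, l₂, h₂, hlt⟩ := h
  rw [mem_eigenvalueSet] at h₁ h₂
  have hs : l₁ + l₂ = tr (fderiv ℝ f u) := by
    have : (l₂ - l₁) * (l₁ + l₂ - tr (fderiv ℝ f u)) = 0 := by linear_combination h₂ - h₁
    rcases mul_eq_zero.1 this with h | h <;> linarith
  have : disc (fderiv ℝ f u) = (l₂ - l₁) ^ 2 := by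
    unfold disc
    rw [← hs] at h₁ ⊢
    linear_combination (-4) * h₁
  rw [this]
  exact pow_pos (sub_pos.2 hlt) 2

/-- The sign in front of the square root in the formula for the `i`-th eigenvalue. -/
def famSign (i : Fin 2) : ℝ := if i = 0 then -1 else 1

lemma famSign_sq (i : Fin 2) : famSign i ^ 2 = 1 := by
  unfold famSign; split_ifs <;> norm_num

lemma charSpeed_eq {f : State → State} {u : State} (h : 0 < disc (fderiv ℝ f u)) (i : Fin 2) :
    charSpeed f i u = (tr (fderiv ℝ f u) + famSign i * √(disc (fderiv ℝ f u))) / 2 := by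
  set A := fderiv ℝ f u
  have hs : 0 < √(disc A) := Real.sqrt_pos.2 h
  have hsq : √(disc A) ^ 2 = disc A := Real.sq_sqrt h.le
  have hset : eigenvalueSet f u = {(tr A - √(disc A)) / 2, (tr A + √(disc A)) / 2} := by
    ext l
    rw [mem_eigenvalueSet]
    have key : l ^ 2 - tr A * l + det A
        = (l - (tr A - √(disc A)) / 2) * (l - (tr A + √(disc A)) / 2) := by
      have : det A = (tr A ^ 2 - √(disc A) ^ 2) / 4 := by rw [hsq]; unfold disc; ring
      rw [this]; ring
    change l ^ 2 - tr A * l + det A = 0 ↔ _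
    rw [key, mul_eq_zero, sub_eq_zero, sub_eq_zero]
    simp
  have hle : (tr A - √(disc A)) / 2 ≤ (tr A + √(disc A)) / 2 := by linarith
  unfold charSpeed famSign
  rw [hset, csInf_pair, csSup_pair, inf_eq_left.2 hle, sup_eq_right.2 hle]
  split_ifs <;> ring

lemma charSpeed_root {f : State → State} {u : State} (h : 0 < disc (fderiv ℝ f u)) (i : Fin 2) :
    charSpeed f i u ^ 2 - tr (fderiv ℝ f u) * charSpeed f i u + det (fderiv ℝ f u) = 0 := by
  rw [charSpeed_eq h]
  have hsq : √(disc (fderiv ℝ f u)) ^ 2 = disc (fderiv ℝ f u) := Real.sq_sqrt h.le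
  have hs := famSign_sq i
  unfold disc at hsq ⊢
  linear_combination (famSign i ^ 2 / 4) * hsq +
    (tr (fderiv ℝ f u) ^ 2 - 4 * det (fderiv ℝ f u)) / 4 * hs

lemma two_mul_charSpeed_sub {f : State → State} {u : State} (h : 0 < disc (fderiv ℝ f u))
    (i : Fin 2) :
    2 * charSpeed f i u - tr (fderiv ℝ f u) = famSign i * √(disc (fderiv ℝ f u)) := by
  rw [charSpeed_eq h]; ring

/-- The Cayley–Hamilton identity: the range of `A - l'`, for the other root `l' = tr A - l`,
consists of eigenvectors for the root `l`. -/
lemma apply_range_eq_smul {A : State →L[ℝ] State} {l : ℝ} (h : l ^ 2 - tr A * l + det A = 0)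
    (x : State) : A (A x - (tr A - l) • x) = l • (A x - (tr A - l) • x) := by
  unfold tr det at h
  ext k
  fin_cases k
  · simp only [map_sub, map_smul, apply_coord, PiLp.sub_apply, PiLp.smul_apply, smul_eq_mul, tr,
      Fin.zero_eta]
    linear_combination (-x 0) * h
  · simp only [map_sub, map_smul, apply_coord, PiLp.sub_apply, PiLp.smul_apply, smul_eq_mul, tr,
      Fin.mk_one]
    linear_combination (-x 1) * h

/-- The eigenspace of a simple eigenvalue is a line. -/
lemma eq_smul_of_eigenvector {A : State →L[ℝ] State} {l : ℝ} (hl : 2 * l - tr A ≠ 0)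
    {r x : State} (hr : ‖r‖ = 1) (hAr : A r = l • r) (hAx : A x = l • x) :
    ∃ c : ℝ, x = c • r := by
  have hr2 : r 0 ^ 2 + r 1 ^ 2 = 1 := by
    have := EuclideanSpace.real_norm_sq_eq r
    rw [hr, Fin.sum_univ_two] at this
    linarith
  have r0 := congrArg (fun y : State => y 0) hAr
  have r1 := congrArg (fun y : State => y 1) hAr
  have x0 := congrArg (fun y : State => y 0) hAx
  have x1 := congrArg (fun y : State => y 1) hAx
  simp only [apply_coord, PiLp.smul_apply, smul_eq_mul] at r0 r1 x0 x1
  have hdet : x 0 * r 1 - x 1 * r 0 = 0 := by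
    have : (2 * l - tr A) * (x 0 * r 1 - x 1 * r 0) = 0 := by
      unfold tr
      linear_combination x 1 * r0 - x 0 * r1 - r 1 * x0 + r 0 * x1
    exact (mul_eq_zero.1 this).resolve_left hl
  refine ⟨x 0 * r 0 + x 1 * r 1, ?_⟩
  ext k
  fin_cases k
  · simp only [PiLp.smul_apply, smul_eq_mul, Fin.zero_eta]
    linear_combination r 1 * hdet - x 0 * hr2
  · simp only [PiLp.smul_apply, smul_eq_mul, Fin.mk_one]
    linear_combination - r 0 * hdet - x 1 * hr2

lemma contDiffAt_entry {f : State → State} {u : State} (hf : ContDiffAt ℝ 2 f u) (j k : Fin 2) :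
    ContDiffAt ℝ 1 (fun x => entry (fderiv ℝ f x) j k) u := by
  have h1 : ContDiffAt ℝ 1 (fderiv ℝ f) u := hf.fderiv_right (by norm_num)
  have h2 : ContDiffAt ℝ 1 (fun x => fderiv ℝ f x (EuclideanSpace.single k 1)) u :=
    h1.clm_apply contDiffAt_const
  exact (EuclideanSpace.proj (𝕜 := ℝ) j).contDiff.contDiffAt.comp u h2

lemma contDiffAt_tr {f : State → State} {u : State} (hf : ContDiffAt ℝ 2 f u) :
    ContDiffAt ℝ 1 (fun x => tr (fderiv ℝ f x)) u :=
  (contDiffAt_entry hf 0 0).add (contDiffAt_entry hf 1 1)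

lemma contDiffAt_disc {f : State → State} {u : State} (hf : ContDiffAt ℝ 2 f u) :
    ContDiffAt ℝ 1 (fun x => disc (fderiv ℝ f x)) u :=
  ((contDiffAt_tr hf).pow 2).sub (contDiffAt_const.mul
    (((contDiffAt_entry hf 0 0).mul (contDiffAt_entry hf 1 1)).sub
      ((contDiffAt_entry hf 0 1).mul (contDiffAt_entry hf 1 0))))

lemma contDiffAt_charSpeed {f : State → State} {u : State} (hf : ContDiffAt ℝ 2 f u)
    (h : 0 < disc (fderiv ℝ f u)) (i : Fin 2) : ContDiffAt ℝ 1 (charSpeed f i) u := by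
  have hd := contDiffAt_disc hf
  have h1 : ContDiffAt ℝ 1
      (fun x => (tr (fderiv ℝ f x) + famSign i * √(disc (fderiv ℝ f x))) / 2) u :=
    ((contDiffAt_tr hf).add (contDiffAt_const.mul (hd.sqrt h.ne'))).div_const 2
  refine h1.congr_of_eventuallyEq ?_
  filter_upwards [hd.continuousAt.eventually (lt_mem_nhds h)] with x hx
  exact charSpeed_eq hx i

/-- At a state where `f'` has distinct real eigenvalues, a left eigenvector `ℓ` and a right
eigenvector `r` for `λᵢ` satisfy `ℓ f''(r, r) = (∇λᵢ · r) ℓ r`. The identity comes from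
differentiating `ℓ (f'(x) - λᵢ(x)) N(x) = 0` with the eigenvector field
`N(x) = (f'(x) - λⱼ(x)) r`. -/
lemma left_eigenvector_second_deriv {f : State → State} {u : State} (hf : ContDiffAt ℝ 2 f u)
    (h : 0 < disc (fderiv ℝ f u)) (i : Fin 2) {r : State} {l : State →L[ℝ] ℝ}
    (hr : fderiv ℝ f u r = charSpeed f i u • r)
    (hl : ∀ x, l (fderiv ℝ f u x) = charSpeed f i u * l x) :
    l (fderiv ℝ (fderiv ℝ f) u r r) = fderiv ℝ (charSpeed f i) u r * l r := by
  have hA : HasFDerivAt (fderiv ℝ f) (fderiv ℝ (fderiv ℝ f) u) u :=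
    ((hf.fderiv_right (m := 1) (by norm_num)).differentiableAt (by norm_num)).hasFDerivAt
  have hlam : HasFDerivAt (charSpeed f i) (fderiv ℝ (charSpeed f i) u) u :=
    ((contDiffAt_charSpeed hf h i).differentiableAt (by norm_num)).hasFDerivAt
  have htr := ((contDiffAt_tr hf).differentiableAt (by norm_num)).hasFDerivAt
  have hN := (hA.clm_apply (hasFDerivAt_const r u)).sub
    ((htr.sub hlam).smul (hasFDerivAt_const r u))
  have hZ := l.hasFDerivAt.comp u ((hA.clm_apply hN).sub (hlam.smul hN))
  have hev : (l ∘ fun x => (fderiv ℝ f x) (fderiv ℝ f x r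
      - (tr (fderiv ℝ f x) - charSpeed f i x) • r) - charSpeed f i x • (fderiv ℝ f x r
      - (tr (fderiv ℝ f x) - charSpeed f i x) • r)) =ᶠ[𝓝 u] fun _ => 0 := by
    filter_upwards [(contDiffAt_disc hf).continuousAt.eventually (lt_mem_nhds h)] with x hx
    simp only [Function.comp]
    rw [apply_range_eq_smul (charSpeed_root hx i), sub_self, map_zero]
  have h0 := hZ.unique ((hasFDerivAt_const (0 : ℝ) u).congr_of_eventuallyEq hev)
  have h1 := congrArg (fun B : State →L[ℝ] ℝ => B r) h0
  simp [hr, hl] at h1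
  have hne : 2 * charSpeed f i u - tr (fderiv ℝ f u) ≠ 0 := by
    rw [two_mul_charSpeed_sub h]
    have := Real.sqrt_pos.2 h
    unfold famSign; split_ifs
    · linarith
    · linarith
  apply mul_left_cancel₀ hne
  linear_combination h1

/-! ### The Hessian of the entropy at the base state -/

lemma hessian_symm {φ : State → ℝ} {u : State} (h : ContDiffAt ℝ 2 φ u) (x y : State) :
    fderiv ℝ (fderiv ℝ φ) u x y = fderiv ℝ (fderiv ℝ φ) u y x :=
  (h.isSymmSndFDerivAt (by simp)).eq x y

/-- Compatibility `∇q = ∇η f'` makes `f'` self-adjoint for the bilinear form `∇²η`. -/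
lemma hessian_flux_symm {f : State → State} {W : Set State} {η q : State → ℝ} (hW : IsOpen W)
    (hη : IsConvexEntropyPair f W η q) {u : State} (hu : u ∈ W) (hf : ContDiffAt ℝ 2 f u)
    (x y : State) :
    fderiv ℝ (fderiv ℝ η) u x (fderiv ℝ f u y) = fderiv ℝ (fderiv ℝ η) u y (fderiv ℝ f u x) := by
  have hηu : ContDiffAt ℝ 2 η u :=
    (hη.contDiffOn_entropy.contDiffAt (hW.mem_nhds hu)).of_le (by norm_num)
  have hqu : ContDiffAt ℝ 2 q u :=
    (hη.contDiffOn_flux.contDiffAt (hW.mem_nhds hu)).of_le (by norm_num)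
  have hA : HasFDerivAt (fderiv ℝ f) (fderiv ℝ (fderiv ℝ f) u) u :=
    ((hf.fderiv_right (m := 1) (by norm_num)).differentiableAt (by norm_num)).hasFDerivAt
  have hE : HasFDerivAt (fderiv ℝ η) (fderiv ℝ (fderiv ℝ η) u) u :=
    ((hηu.fderiv_right (m := 1) (by norm_num)).differentiableAt (by norm_num)).hasFDerivAt
  have hQ : HasFDerivAt (fderiv ℝ q) (fderiv ℝ (fderiv ℝ q) u) u :=
    ((hqu.fderiv_right (m := 1) (by norm_num)).differentiableAt (by norm_num)).hasFDerivAt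
  have key : ∀ a b : State, fderiv ℝ (fderiv ℝ q) u a b
      = fderiv ℝ (fderiv ℝ η) u a (fderiv ℝ f u b)
        + fderiv ℝ η u (fderiv ℝ (fderiv ℝ f) u a b) := by
    intro a b
    have h1 := hE.clm_apply (hA.clm_apply (hasFDerivAt_const b u))
    have h2 := hQ.clm_apply (hasFDerivAt_const b u)
    have hev : (fun x => fderiv ℝ q x b) =ᶠ[𝓝 u] fun x => fderiv ℝ η x (fderiv ℝ f x b) := by
      filter_upwards [hW.mem_nhds hu] with x hx
      rw [hη.compatible x hx]; rfl
    have h3 := congrArg (fun B : State →L[ℝ] ℝ => B a)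
      (h2.unique (h1.congr_of_eventuallyEq hev))
    simp at h3
    linarith
  have hfs : fderiv ℝ (fderiv ℝ f) u x y = fderiv ℝ (fderiv ℝ f) u y x :=
    (hf.isSymmSndFDerivAt (by simp)).eq x y
  have := hessian_symm hqu x y
  rw [key, key, hfs] at this
  linarith

/-- A nonnegative function whose zeros on a compact set lie in `{a < 0}` controls `a` there. -/
lemma exists_const_sub_neg {S : Set State} (hS : IsCompact S) {a b : State → ℝ}
    (ha : Continuous a) (hb : Continuous b) (hb0 : ∀ x ∈ S, 0 ≤ b x)
    (hab : ∀ x ∈ S, b x = 0 → a x < 0) : ∃ C > 0, ∀ x ∈ S, a x - C * b x < 0 := by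
  have hS' : IsCompact (S ∩ {x | 0 ≤ a x}) := hS.inter_right (isClosed_le continuous_const ha)
  rcases (S ∩ {x | 0 ≤ a x}).eq_empty_or_nonempty with he | hne
  · refine ⟨1, one_pos, fun x hx => ?_⟩
    have : ¬ 0 ≤ a x := fun h => (he ▸ (⟨hx, h⟩ : x ∈ S ∩ {x | 0 ≤ a x}) : x ∈ (∅ : Set State))
    linarith [hb0 x hx]
  · obtain ⟨y, hy, hymin⟩ := hS'.exists_isMinOn hne hb.continuousOn
    obtain ⟨z, hz, hzmax⟩ := hS'.exists_isMaxOn hne ha.continuousOn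
    have hby : 0 < b y := lt_of_le_of_ne (hb0 y hy.1) fun h =>
      absurd (hab y hy.1 h.symm) (not_lt.2 hy.2)
    have haz : 0 ≤ a z := hz.2
    refine ⟨(a z + 1) / b y, by positivity, fun x hx => ?_⟩
    by_cases hax : 0 ≤ a x
    · have h1 : b y ≤ b x := hymin ⟨hx, hax⟩
      have h2 : a x ≤ a z := hzmax ⟨hx, hax⟩
      have h3 : a z + 1 ≤ (a z + 1) / b y * b x := by
        rw [div_mul_eq_mul_div, le_div_iff₀ hby]
        exact mul_le_mul_of_nonneg_left h1 (by linarith)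
      linarith
    · have : 0 ≤ (a z + 1) / b y * b x := mul_nonneg (by positivity) (hb0 x hx)
      linarith

lemma exists_isCharVector {f : State → State} {d : State}
    (hd : 0 < disc (fderiv ℝ f d)) (i : Fin 2) (hgn : GenuinelyNonlinearAt f i d) :
    ∃ r, IsCharVector f i d r := by
  obtain ⟨x, hx, hxA⟩ := (exists_eigenvector_iff _ _).2 (charSpeed_root hd i)
  have hx' : ‖x‖ ≠ 0 := norm_ne_zero_iff.2 hx
  have key : ∀ c : ℝ, |c| = ‖x‖⁻¹ → 0 < fderiv ℝ (charSpeed f i) d (c • x) →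
      ∃ r, IsCharVector f i d r := fun c hc hpos =>
    ⟨c • x, by rw [norm_smul, Real.norm_eq_abs, hc, inv_mul_cancel₀ hx'],
      by rw [map_smul, hxA, smul_comm], hpos⟩
  have hinv : 0 < ‖x‖⁻¹ := by positivity
  rcases lt_or_gt_of_ne (hgn x hx hxA) with h | h
  · refine key (-‖x‖⁻¹) (by rw [abs_neg, abs_of_pos hinv]) ?_
    rw [map_smul, smul_eq_mul]; nlinarith
  · refine key ‖x‖⁻¹ (abs_of_pos hinv) ?_
    rw [map_smul, smul_eq_mul]; positivity

lemma two_mul_charSpeed_sub_ne_zero {f : State → State} {u : State}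
    (h : 0 < disc (fderiv ℝ f u)) (i : Fin 2) :
    2 * charSpeed f i u - tr (fderiv ℝ f u) ≠ 0 := by
  rw [two_mul_charSpeed_sub h]
  have := Real.sqrt_pos.2 h
  unfold famSign; split_ifs
  · linarith
  · linarith

/-- For a large weight `C`, the quadratic form `-ℓ f''(ξ,ξ) ± C ∇²η(ξ, (f' - λᵢ)ξ)` with
`ℓ = ∇²η rᵢ` is negative definite. In the direction `rᵢ` the first term is negative by genuine
nonlinearity; `f' - λᵢ` is semidefinite for `∇²η`, and the second term takes care of the other
characteristic direction. -/
lemma exists_weight {f : State → State} {W : Set State} {η q : State → ℝ} {d : State}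
    (hW : IsOpen W) (hdW : d ∈ W) (hη : IsConvexEntropyPair f W η q)
    (hf : ContDiffAt ℝ 2 f d) (hd : 0 < disc (fderiv ℝ f d)) (i : Fin 2) {r : State}
    (hr : IsCharVector f i d r) :
    ∃ C > 0, ∀ c ≥ C, ∀ ξ : State, ‖ξ‖ = 1 →
      famSign i * c * fderiv ℝ (fderiv ℝ η) d ξ (fderiv ℝ f d ξ - charSpeed f i d • ξ)
        - fderiv ℝ (fderiv ℝ η) d r (fderiv ℝ (fderiv ℝ f) d ξ ξ) < 0 := by
  set lam := charSpeed f i d with hlam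
  set A := fderiv ℝ f d with hA
  set H := fderiv ℝ (fderiv ℝ η) d with hH
  have hηd : ContDiffAt ℝ 2 η d :=
    (hη.contDiffOn_entropy.contDiffAt (hW.mem_nhds hdW)).of_le (by norm_num)
  have hsymm : ∀ x y, H x (A y) = H y (A x) := hessian_flux_symm hW hη hdW hf
  have hHs : ∀ x y, H x y = H y x := hessian_symm hηd
  have hpos : ∀ x, x ≠ 0 → 0 < H x x := hη.hessian_pos d hdW
  have hs := two_mul_charSpeed_sub hd i
  have hsq : 0 < √(disc A) := Real.sqrt_pos.2 hd
  have hB : ∀ ξ, H (A ξ - lam • ξ) (A ξ - lam • ξ)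
      = - famSign i * √(disc A) * H ξ (A ξ - lam • ξ) := by
    intro ξ
    have h2 : A (A ξ - lam • ξ) = (tr A - lam) • (A ξ - lam • ξ) := by
      have h3 : (tr A - lam) ^ 2 - tr A * (tr A - lam) + det A = 0 := by
        linear_combination charSpeed_root hd i
      simpa using apply_range_eq_smul h3 ξ
    set y := A ξ - lam • ξ with hy
    have h4 : H y y = H y (A ξ) - lam * H y ξ := by
      have h6 : H y (A ξ - lam • ξ) = H y (A ξ) - lam * H y ξ := by
        rw [map_sub, map_smul, smul_eq_mul]
      rwa [← hy] at h6
    have h5 : H y (A ξ) = (tr A - lam) * H ξ y := by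
      rw [← hsymm ξ y, h2, map_smul, smul_eq_mul]
    rw [h4, h5, hHs y ξ]
    linear_combination (-H ξ y) * hs
  have hsB : ∀ ξ, - famSign i * H ξ (A ξ - lam • ξ)
      = H (A ξ - lam • ξ) (A ξ - lam • ξ) / √(disc A) := by
    intro ξ; rw [hB]; field_simp
  have hnn : ∀ x, 0 ≤ H x x := fun x => by
    by_cases hx : x = 0
    · simp [hx]
    · exact (hpos x hx).le
  have hr0 : r ≠ 0 := by intro h; have := hr.1; simp [h] at this
  obtain ⟨C, hC, hC'⟩ := exists_const_sub_neg (isCompact_sphere (0 : State) 1)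
    (a := fun ξ => - H r (fderiv ℝ (fderiv ℝ f) d ξ ξ))
    (b := fun ξ => - famSign i * H ξ (A ξ - lam • ξ)) (by fun_prop) (by fun_prop)
    (fun ξ _ => by
      simp only [hsB]
      exact div_nonneg (hnn _) hsq.le)
    (fun ξ hξ h0 => by
      have hξ1 : ‖ξ‖ = 1 := by simpa using hξ
      simp only [hsB] at h0
      have hy : A ξ - lam • ξ = 0 := by
        by_contra hne
        exact (div_pos (hpos _ hne) hsq).ne' h0
      obtain ⟨c, rfl⟩ := eq_smul_of_eigenvector (two_mul_charSpeed_sub_ne_zero hd i) hr.1 hr.2.1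
        (sub_eq_zero.1 hy)
      have hc : 0 < c ^ 2 := by
        rw [norm_smul, hr.1, mul_one, Real.norm_eq_abs] at hξ1
        rw [← sq_abs, hξ1]; norm_num
      have hl : ∀ x, H r (A x) = lam * H r x := by
        intro x
        rw [hsymm, hr.2.1, map_smul, smul_eq_mul, hHs x r]
      have h1 := left_eigenvector_second_deriv hf hd i (l := H r) hr.2.1 hl
      have h2 : H r (fderiv ℝ (fderiv ℝ f) d (c • r) (c • r))
          = c ^ 2 * (fderiv ℝ (charSpeed f i) d r * H r r) := by
        rw [← h1]; simp; ring
      have h3 := mul_pos hc (mul_pos hr.2.2 (hpos r hr0))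
      simp only [h2]; linarith)
  refine ⟨C, hC, fun c hc ξ hξ => ?_⟩
  have h1 := hC' ξ (by simpa using hξ)
  have h2 : 0 ≤ - famSign i * H ξ (A ξ - lam • ξ) := by
    rw [hsB]; exact div_nonneg (hnn _) hsq.le
  nlinarith

/-- Characteristic vectors at nearby states are close to the one at `d`. -/
lemma eventually_of_isCharVector {f : State → State} {d : State} (hf : ContDiffAt ℝ 2 f d)
    (hd : 0 < disc (fderiv ℝ f d)) (i : Fin 2) {r : State} (hr : IsCharVector f i d r)
    {P : State → State → Prop} (hP : ∀ᶠ z : State × State in 𝓝 (d, r), P z.1 z.2) :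
    ∀ᶠ u in 𝓝 d, ∀ v, IsCharVector f i u v → P u v := by
  have hA : ContinuousAt (fderiv ℝ f) d :=
    (hf.fderiv_right (m := 1) (by norm_num)).continuousAt
  have hlamC := contDiffAt_charSpeed hf hd i
  have hlam : ContinuousAt (charSpeed f i) d := hlamC.continuousAt
  have hdlam : ContinuousAt (fderiv ℝ (charSpeed f i)) d :=
    (hlamC.fderiv_right (m := 0) (by norm_num)).continuousAt
  have h := (isCompact_sphere (0 : State) 1).eventually_forall_of_forall_eventually
    (x₀ := d) (P := fun u v => IsCharVector f i u v → P u v) (fun y hy => by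
      have hy1 : ‖y‖ = 1 := by simpa using hy
      by_cases hyr : y = r
      · subst hyr
        filter_upwards [hP] with z hz _ using hz
      have c1 : ContinuousAt (fun z : State × State => z.1) (d, y) := continuousAt_fst
      have c2 : ContinuousAt (fun z : State × State => z.2) (d, y) := continuousAt_snd
      have cA : ContinuousAt (fun z : State × State => fderiv ℝ f z.1) (d, y) :=
        ContinuousAt.comp (g := fderiv ℝ f) (f := fun z : State × State => z.1) hA c1
      have cl : ContinuousAt (fun z : State × State => charSpeed f i z.1) (d, y) :=
        ContinuousAt.comp (g := charSpeed f i) (f := fun z : State × State => z.1) hlam c1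
      have cdl : ContinuousAt (fun z : State × State => fderiv ℝ (charSpeed f i) z.1) (d, y) :=
        ContinuousAt.comp (f := fun z : State × State => z.1) hdlam c1
      by_cases hye : fderiv ℝ f d y = charSpeed f i d • y
      · obtain ⟨c, rfl⟩ := eq_smul_of_eigenvector (two_mul_charSpeed_sub_ne_zero hd i) hr.1 hr.2.1
          hye
        have hc : c = -1 := by
          rw [norm_smul, hr.1, mul_one, Real.norm_eq_abs] at hy1
          rcases eq_or_eq_neg_of_abs_eq hy1 with h | h
          · exact absurd (by rw [h, one_smul]) hyr
          · exact h
        have hneg : fderiv ℝ (charSpeed f i) d (c • r) < 0 := by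
          rw [hc]; simpa using hr.2.2
        filter_upwards [(cdl.clm_apply c2).eventually (gt_mem_nhds hneg)] with z hz hcv
        exact absurd hcv.2.2 (not_lt.2 (le_of_lt hz))
      · have := (cA.clm_apply c2).sub (cl.smul c2)
        filter_upwards [this.eventually (isOpen_ne.mem_nhds (sub_ne_zero.2 hye))] with z hz hcv
        exact absurd (sub_eq_zero.2 hcv.2.1) hz)
  filter_upwards [h] with u hu v hv
  exact hu v (by simpa using hv.1) hv

/-! ### Rarefaction curves with close endpoints -/

/-- A rarefaction curve with both endpoints close to `d` stays close to `d`: since `λᵢ` increases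
along the curve, and at a definite rate as long as the curve is near `d`, a curve that leaves a
neighbourhood of `d` cannot end at a state whose speed is close to `λᵢ(d)`. -/
lemma rarefactionCurve_local {f : State → State} {d : State} (hf : ContDiffAt ℝ 2 f d)
    (hd : 0 < disc (fderiv ℝ f d)) (i : Fin 2) {r : State} (hr : IsCharVector f i d r) :
    ∃ c > 0, ∀ δ > 0, ∀ᶠ ε in 𝓝[>] (0 : ℝ), ∀ (uL uR : State) (s₀ : ℝ) (R : ℝ → State),
      ‖uL - d‖ + ‖uR - d‖ ≤ ε → 0 < s₀ → IsRarefactionCurve f i uL s₀ R → R s₀ = uR →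
      (∀ s ∈ Icc 0 s₀, R s ∈ Metric.ball d δ) ∧
        c * s₀ ≤ charSpeed f i uR - charSpeed f i uL ∧
        (∀ s ∈ Icc 0 s₀, charSpeed f i uL ≤ charSpeed f i (R s) ∧
          charSpeed f i (R s) ≤ charSpeed f i uR) ∧
        ∀ s ∈ Icc 0 s₀, ‖R s - uL‖ ≤ s := by
  have hlam := contDiffAt_charSpeed hf hd i
  have hdlam : ContinuousAt (fderiv ℝ (charSpeed f i)) d :=
    (hlam.fderiv_right (m := 0) (by norm_num)).continuousAt
  obtain ⟨c, hc0, hcr⟩ := exists_between hr.2.2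
  have hP : ∀ᶠ z : State × State in 𝓝 (d, r), c ≤ fderiv ℝ (charSpeed f i) z.1 z.2 := by
    have h : ContinuousAt (fun z : State × State => fderiv ℝ (charSpeed f i) z.1 z.2) (d, r) :=
      ContinuousAt.clm_apply (ContinuousAt.comp (g := fderiv ℝ (charSpeed f i))
        (f := fun z : State × State => z.1) hdlam continuousAt_fst) continuousAt_snd
    exact (h.eventually (lt_mem_nhds hcr)).mono fun z hz => le_of_lt hz
  have hev := eventually_of_isCharVector hf hd i hr
    (P := fun u v => c ≤ fderiv ℝ (charSpeed f i) u v) hP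
  obtain ⟨L, S, hS, hL⟩ := hlam.exists_lipschitzOnWith
  refine ⟨c, hc0, fun δ hδ => ?_⟩
  obtain ⟨ρ₀, hρ₀, hball⟩ := Metric.eventually_nhds_iff_ball.1 (hev.and hS)
  obtain ⟨ρ, hρ, hρδ⟩ := exists_between (lt_min hρ₀ hδ)
  have hρρ₀ : ρ < ρ₀ := hρδ.trans_le (min_le_left _ _)
  have hρ' : ρ < δ := hρδ.trans_le (min_le_right _ _)
  have h1 : ∀ᶠ ε in 𝓝[>] (0 : ℝ), ε < ρ :=
    nhdsWithin_le_nhds (gt_mem_nhds hρ)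
  have h2 : ∀ᶠ ε in 𝓝[>] (0 : ℝ), L * ε < c * (ρ - ε) := by
    have : ContinuousAt (fun ε : ℝ => c * (ρ - ε) - L * ε) 0 := by fun_prop
    have h := this.eventually (lt_mem_nhds (a := 0) (by simp; positivity))
    exact nhdsWithin_le_nhds (h.mono fun ε hε => sub_pos.1 hε)
  filter_upwards [h1, h2] with ε hερ hLε uL uR s₀ R hLR hs₀ hR hRs
  obtain ⟨hR0, hR'⟩ := hR
  choose! V hV hVd using hR'
  have huL : ‖uL - d‖ ≤ ε := by linarith [norm_nonneg (uR - d)]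
  have huR : ‖uR - d‖ ≤ ε := by linarith [norm_nonneg (uL - d)]
  have hRc : ContinuousOn R (Icc 0 s₀) := fun s hs => (hVd s hs).continuousWithinAt
  have hΛ : ∀ s ∈ Icc 0 s₀, HasDerivWithinAt (fun s => charSpeed f i (R s))
      (fderiv ℝ (charSpeed f i) (R s) (V s)) (Icc 0 s₀) s := by
    intro s hs
    have hdiff : DifferentiableAt ℝ (charSpeed f i) (R s) := by
      by_contra h
      have := (hV s hs).2.2
      rw [fderiv_zero_of_not_differentiableAt h] at this
      simp at this
    exact hdiff.hasFDerivAt.comp_hasDerivWithinAt s (hVd s hs)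
  have hΛc : ContinuousOn (fun s => charSpeed f i (R s)) (Icc 0 s₀) :=
    fun s hs => (hΛ s hs).continuousWithinAt
  have hΛi : ∀ s ∈ Ioo 0 s₀, HasDerivAt (fun s => charSpeed f i (R s))
      (fderiv ℝ (charSpeed f i) (R s) (V s)) s := fun s hs =>
    (hΛ s (Ioo_subset_Icc_self hs)).hasDerivAt (Icc_mem_nhds hs.1 hs.2)
  have hmono : MonotoneOn (fun s => charSpeed f i (R s)) (Icc 0 s₀) := by
    refine monotoneOn_of_deriv_nonneg (convex_Icc _ _) hΛc ?_ ?_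
    · rw [interior_Icc]
      exact fun s hs => (hΛi s hs).differentiableAt.differentiableWithinAt
    · rw [interior_Icc]
      intro s hs
      rw [(hΛi s hs).deriv]
      exact (hV s (Ioo_subset_Icc_self hs)).2.2.le
  have hnorm : ∀ s ∈ Icc 0 s₀, ‖R s - uL‖ ≤ s := by
    intro s hs
    have := (convex_Icc 0 s₀).norm_image_sub_le_of_norm_hasDerivWithin_le (C := 1) hVd
      (fun x hx => (hV x hx).1.le) (left_mem_Icc.2 hs₀.le) hs
    rw [hR0] at this
    simpa [abs_of_nonneg hs.1] using this
  -- growth of the speed on an initial piece of the curve that lies in the ball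
  have hgrow : ∀ s₁ ∈ Icc 0 s₀, (∀ s ∈ Ioo 0 s₁, R s ∈ Metric.ball d ρ₀) →
      c * s₁ ≤ charSpeed f i (R s₁) - charSpeed f i uL := by
    intro s₁ hs₁ hin
    have hsub : Icc 0 s₁ ⊆ Icc 0 s₀ := Icc_subset_Icc le_rfl hs₁.2
    have hsubi : Ioo 0 s₁ ⊆ Ioo 0 s₀ := Ioo_subset_Ioo le_rfl hs₁.2
    have := (convex_Icc 0 s₁).mul_sub_le_image_sub_of_le_deriv (hΛc.mono hsub)
      (by
        rw [interior_Icc]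
        exact fun s hs => (hΛi s (hsubi hs)).differentiableAt.differentiableWithinAt)
      (C := c) (by
        rw [interior_Icc]
        intro s hs
        rw [(hΛi s (hsubi hs)).deriv]
        exact (hball (R s) (hin s hs)).1 (V s) (hV s (Ioo_subset_Icc_self (hsubi hs))))
      0 (left_mem_Icc.2 hs₁.1) s₁ (right_mem_Icc.2 hs₁.1) hs₁.1
    simpa [hR0] using this
  have hspeed : charSpeed f i uR - charSpeed f i uL ≤ L * ε := by
    have h3 : uR ∈ S := (hball uR (by rw [mem_ball_iff_norm]; linarith)).2
    have h4 : uL ∈ S := (hball uL (by rw [mem_ball_iff_norm]; linarith)).2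
    have h5 := hL.norm_sub_le h3 h4
    have h6 : ‖uR - uL‖ ≤ ε := by
      have : uR - uL = (uR - d) - (uL - d) := by abel
      rw [this]; exact (norm_sub_le _ _).trans (by linarith)
    exact (le_abs_self _).trans (h5.trans (mul_le_mul_of_nonneg_left h6 L.2))
  have hstay : ∀ s ∈ Icc 0 s₀, R s ∈ Metric.ball d ρ := by
    by_contra! hex
    obtain ⟨s, hs, hsout⟩ := hex
    have hcl : IsCompact (Icc 0 s₀ ∩ (fun s => ‖R s - d‖) ⁻¹' Ici ρ) := by
      refine isCompact_Icc.of_isClosed_subset ?_ inter_subset_left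
      exact (hRc.sub continuousOn_const).norm.preimage_isClosed_of_isClosed isClosed_Icc
        isClosed_Ici
    -- the first exit from the ball
    obtain ⟨s₁, hs₁, hmin⟩ := hcl.exists_isLeast
      ⟨s, hs, by rw [mem_ball_iff_norm, not_lt] at hsout; exact hsout⟩
    have hin : ∀ s ∈ Ioo 0 s₁, R s ∈ Metric.ball d ρ₀ := by
      intro s hs
      rw [mem_ball_iff_norm]
      by_contra! hge
      exact absurd (hmin ⟨⟨hs.1.le, hs.2.le.trans hs₁.1.2⟩, hρρ₀.le.trans hge⟩) (not_le.2 hs.2)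
    have h3 := hgrow s₁ hs₁.1 hin
    have h4 : ρ ≤ ‖R s₁ - d‖ := hs₁.2
    have h5 := hnorm s₁ hs₁.1
    have h6 : ‖R s₁ - d‖ ≤ ‖R s₁ - uL‖ + ‖uL - d‖ := by
      have : R s₁ - d = (R s₁ - uL) + (uL - d) := by abel
      rw [this]; exact norm_add_le _ _
    have h7 : charSpeed f i (R s₁) ≤ charSpeed f i uR := by
      have := hmono hs₁.1 (right_mem_Icc.2 hs₀.le) hs₁.1.2
      simpa only [hRs] using this
    have h8 : c * (ρ - ε) ≤ c * s₁ := mul_le_mul_of_nonneg_left (by linarith) hc0.le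
    linarith
  refine ⟨fun s hs => Metric.ball_subset_ball hρ'.le (hstay s hs), ?_, fun s hs => ⟨?_, ?_⟩, hnorm⟩
  · have := hgrow s₀ (right_mem_Icc.2 hs₀.le) fun s hs =>
      Metric.ball_subset_ball hρρ₀.le (hstay s (Ioo_subset_Icc_self hs))
    rwa [hRs] at this
  · have := hmono (left_mem_Icc.2 hs₀.le) hs hs.1
    simpa only [hR0] using this
  · have := hmono hs (right_mem_Icc.2 hs₀.le) hs.2
    simpa only [hRs] using this

/-! ### The pointwise estimate -/

/-- The relative entropy flux `q(a;b) - v η(a|b)` through a line of speed `v`. -/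
noncomputable def relSpeedFlux (f : State → State) (η q : State → ℝ) (v : ℝ) (b a : State) : ℝ :=
  relFlux f η q a b - v * relEntropy η a b

lemma relSpeedFlux_self (f : State → State) (η q : State → ℝ) (v : ℝ) (b : State) :
    relSpeedFlux f η q v b b = 0 := by
  simp [relSpeedFlux, relFlux, relEntropy]

lemma hasFDerivAt_relSpeedFlux {f : State → State} {η q : State → ℝ} {x : State}
    (hf : DifferentiableAt ℝ f x) (hη : DifferentiableAt ℝ η x) (hq : DifferentiableAt ℝ q x)
    (hc : fderiv ℝ q x = (fderiv ℝ η x).comp (fderiv ℝ f x)) (v : ℝ) (b : State) :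
    HasFDerivAt (relSpeedFlux f η q v b)
      ((fderiv ℝ η x - fderiv ℝ η b).comp (fderiv ℝ f x - v • ContinuousLinearMap.id ℝ State))
      x := by
  have h1 := (hq.hasFDerivAt.sub_const (q b)).sub
    ((fderiv ℝ η b).hasFDerivAt.comp x (hf.hasFDerivAt.sub_const (f b)))
  have h2 := ((hη.hasFDerivAt.sub_const (η b)).sub
    ((fderiv ℝ η b).hasFDerivAt.comp x ((hasFDerivAt_id x).sub_const b))).const_mul v
  refine (h1.sub h2).congr_fderiv ?_
  rw [hc]
  ext z
  simp

lemma hasDerivAt_relSpeedFlux_deriv {f : State → State} {η : State → ℝ} {z a : State} {t : ℝ}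
    (hf : DifferentiableAt ℝ (fderiv ℝ f) (a + t • z))
    (hη : DifferentiableAt ℝ (fderiv ℝ η) (a + t • z)) (v : ℝ) (b : State) :
    HasDerivAt (fun t : ℝ => (fderiv ℝ η (a + t • z) - fderiv ℝ η b)
        (fderiv ℝ f (a + t • z) z - v • z))
      (fderiv ℝ (fderiv ℝ η) (a + t • z) z (fderiv ℝ f (a + t • z) z - v • z)
        + (fderiv ℝ η (a + t • z) - fderiv ℝ η b)
          (fderiv ℝ (fderiv ℝ f) (a + t • z) z z)) t := by
  have hx : HasDerivAt (fun t : ℝ => a + t • z) z t := by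
    simpa using ((hasDerivAt_id t).smul_const z).const_add a
  have h1 : HasDerivAt (fun t : ℝ => fderiv ℝ η (a + t • z) - fderiv ℝ η b)
      (fderiv ℝ (fderiv ℝ η) (a + t • z) z) t :=
    (hη.hasFDerivAt.comp_hasDerivAt t hx).sub_const (fderiv ℝ η b)
  have h2 : HasDerivAt (fun t : ℝ => fderiv ℝ f (a + t • z))
      (fderiv ℝ (fderiv ℝ f) (a + t • z) z) t := hf.hasFDerivAt.comp_hasDerivAt t hx
  have h3 : HasDerivAt (fun t : ℝ => fderiv ℝ f (a + t • z) z - v • z)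
      (fderiv ℝ (fderiv ℝ f) (a + t • z) z z) t := by
    have := (h2.clm_apply (hasDerivAt_const t z)).sub_const (v • z)
    rwa [map_zero, add_zero] at this
  exact h1.clm_apply h3

/-- A function with nonpositive second derivative lies below its tangent. -/
lemma le_tangent {φ φ' φ'' : ℝ → ℝ} (h1 : ∀ t ∈ Icc (0 : ℝ) 1, HasDerivAt φ (φ' t) t)
    (h2 : ∀ t ∈ Icc (0 : ℝ) 1, HasDerivAt φ' (φ'' t) t) (h3 : ∀ t ∈ Icc (0 : ℝ) 1, φ'' t ≤ 0) :
    φ 1 ≤ φ 0 + φ' 0 := by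
  have hanti : AntitoneOn φ' (Icc 0 1) := by
    refine antitoneOn_of_deriv_nonpos (convex_Icc _ _)
      (fun t ht => (h2 t ht).continuousAt.continuousWithinAt) ?_ ?_
    · exact fun t ht => (h2 t (interior_subset ht)).differentiableAt.differentiableWithinAt
    · intro t ht
      rw [(h2 t (interior_subset ht)).deriv]
      exact h3 t (interior_subset ht)
  have := (convex_Icc (0 : ℝ) 1).image_sub_le_mul_sub_of_deriv_le
    (fun t ht => (h1 t ht).continuousAt.continuousWithinAt)
    (fun t ht => (h1 t (interior_subset ht)).differentiableAt.differentiableWithinAt)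
    (C := φ' 0) (fun t ht => by
      rw [(h1 t (interior_subset ht)).deriv]
      exact hanti (left_mem_Icc.2 zero_le_one) (interior_subset ht) (interior_subset ht).1)
    0 (left_mem_Icc.2 zero_le_one) 1 (right_mem_Icc.2 zero_le_one) zero_le_one
  linarith

/-- For admissible weights, `(1 - a₁/a₂)/s₀` has the sign of the family and size
between `C₂/2` and `2C₂`. -/
lemma exists_eq_of_admissibleWeights {i : Fin 2} {C₂ s₀ a₁ a₂ : ℝ} (hs₀ : 0 < s₀)
    (h : AdmissibleWeights i C₂ s₀ a₁ a₂) :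
    ∃ k ∈ Icc (C₂ / 2) (2 * C₂), 1 - a₁ / a₂ = s₀ * (famSign i * k) := by
  unfold AdmissibleWeights at h
  unfold famSign
  split_ifs at h ⊢
  · refine ⟨(a₁ / a₂ - 1) / s₀, ⟨?_, ?_⟩, by field_simp; ring⟩
    · rw [le_div_iff₀ hs₀]; linarith [h.1]
    · rw [div_le_iff₀ hs₀]; linarith [h.2]
  · refine ⟨(1 - a₁ / a₂) / s₀, ⟨?_, ?_⟩, by field_simp⟩
    · rw [le_div_iff₀ hs₀]; linarith [h.2]
    · rw [div_le_iff₀ hs₀]; linarith [h.1]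

/-- The quadratic form of `exists_weight` stays negative definite under small perturbations of all
its coefficients, uniformly for weights in a bounded range. -/
lemma eventually_quadratic_neg {f : State → State} {η : State → ℝ} {d r : State} {i : Fin 2} {C : ℝ}
    (hf : ContDiffAt ℝ 4 f d) (hη : ContDiffAt ℝ 3 η d)
    (hC : ∀ c ≥ C, ∀ ξ : State, ‖ξ‖ = 1 →
      famSign i * c * fderiv ℝ (fderiv ℝ η) d ξ (fderiv ℝ f d ξ - charSpeed f i d • ξ)
        - fderiv ℝ (fderiv ℝ η) d r (fderiv ℝ (fderiv ℝ f) d ξ ξ) < 0) (C' : ℝ) :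
    ∀ᶠ Y : (State →L[ℝ] ℝ) × State × ℝ × State in
      𝓝 (fderiv ℝ (fderiv ℝ η) d r, d, charSpeed f i d, d), ∀ k ∈ Icc C C', ∀ ξ : State,
        famSign i * k * (fderiv ℝ (fderiv ℝ η) Y.2.2.2 ξ (fderiv ℝ f Y.2.2.2 ξ - Y.2.2.1 • ξ)
          + (fderiv ℝ η Y.2.2.2 - fderiv ℝ η Y.2.1) (fderiv ℝ (fderiv ℝ f) Y.2.2.2 ξ ξ))
          - Y.1 (fderiv ℝ (fderiv ℝ f) Y.2.2.2 ξ ξ) ≤ 0 := by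
  have f1 : ContDiffAt ℝ 3 (fderiv ℝ f) d := hf.fderiv_right (by norm_num)
  have f2 : ContDiffAt ℝ 2 (fderiv ℝ (fderiv ℝ f)) d := f1.fderiv_right (by norm_num)
  have e1 : ContDiffAt ℝ 2 (fderiv ℝ η) d := hη.fderiv_right (by norm_num)
  have e2 : ContDiffAt ℝ 1 (fderiv ℝ (fderiv ℝ η)) d := e1.fderiv_right (by norm_num)
  have h := ((isCompact_Icc (a := C) (b := C')).prod
      (isCompact_sphere (0 : State) 1)).eventually_forall_of_forall_eventually
    (x₀ := (fderiv ℝ (fderiv ℝ η) d r, d, charSpeed f i d, d))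
    (P := fun (Y : (State →L[ℝ] ℝ) × State × ℝ × State) (X : ℝ × State) =>
      famSign i * X.1 * (fderiv ℝ (fderiv ℝ η) Y.2.2.2 X.2 (fderiv ℝ f Y.2.2.2 X.2 - Y.2.2.1 • X.2)
          + (fderiv ℝ η Y.2.2.2 - fderiv ℝ η Y.2.1) (fderiv ℝ (fderiv ℝ f) Y.2.2.2 X.2 X.2))
          - Y.1 (fderiv ℝ (fderiv ℝ f) Y.2.2.2 X.2 X.2) < 0) (fun X hX => by
      have hneg := hC X.1 hX.1.1 X.2 (by simpa using hX.2)
      set Z₀ : ((State →L[ℝ] ℝ) × State × ℝ × State) × ℝ × State :=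
        ((fderiv ℝ (fderiv ℝ η) d r, d, charSpeed f i d, d), X) with hZ₀
      have cx : ContinuousAt (fun Z : ((State →L[ℝ] ℝ) × State × ℝ × State) × ℝ × State =>
        Z.1.2.2.2) Z₀ := by fun_prop
      have cb : ContinuousAt (fun Z : ((State →L[ℝ] ℝ) × State × ℝ × State) × ℝ × State =>
        Z.1.2.1) Z₀ := by fun_prop
      have cf1 := ContinuousAt.comp (g := fderiv ℝ f) (x := Z₀) f1.continuousAt cx
      have cf2 := ContinuousAt.comp (g := fderiv ℝ (fderiv ℝ f)) (x := Z₀) f2.continuousAt cx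
      have ce1 := ContinuousAt.comp (g := fderiv ℝ η) (x := Z₀) e1.continuousAt cx
      have ce1b := ContinuousAt.comp (g := fderiv ℝ η) (x := Z₀) e1.continuousAt cb
      have ce2 := ContinuousAt.comp (g := fderiv ℝ (fderiv ℝ η)) (x := Z₀) e2.continuousAt cx
      have cξ : ContinuousAt (fun Z : ((State →L[ℝ] ℝ) × State × ℝ × State) × ℝ × State =>
        Z.2.2) Z₀ := by fun_prop
      have cv : ContinuousAt (fun Z : ((State →L[ℝ] ℝ) × State × ℝ × State) × ℝ × State =>
        Z.1.2.2.1) Z₀ := by fun_prop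
      have cp : ContinuousAt (fun Z : ((State →L[ℝ] ℝ) × State × ℝ × State) × ℝ × State =>
        Z.1.1) Z₀ := by fun_prop
      have ck : ContinuousAt (fun Z : ((State →L[ℝ] ℝ) × State × ℝ × State) × ℝ × State =>
        famSign i * Z.2.1) Z₀ := by fun_prop
      have cff := (cf2.clm_apply cξ).clm_apply cξ
      have call := (ck.mul (((ce2.clm_apply cξ).clm_apply ((cf1.clm_apply cξ).sub
        (cv.smul cξ))).add ((ce1.sub ce1b).clm_apply cff))).sub (cp.clm_apply cff)
      exact call.eventually (gt_mem_nhds (by simpa [hZ₀] using hneg)))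
  filter_upwards [h] with Y hY k hk ξ
  by_cases hξ : ξ = 0
  · simp [hξ]
  have hn : 0 < ‖ξ‖ := norm_pos_iff.2 hξ
  have h1 := hY (k, ‖ξ‖⁻¹ • ξ) ⟨hk, by simp [norm_smul, hn.ne']⟩
  have h2 : ξ = ‖ξ‖ • (‖ξ‖⁻¹ • ξ) := by rw [smul_smul, mul_inv_cancel₀ hn.ne', one_smul]
  simp only at h1
  rw [h2]
  generalize ‖ξ‖⁻¹ • ξ = y at h1 ⊢
  have h3 := mul_nonpos_of_nonneg_of_nonpos (sq_nonneg ‖ξ‖) h1.le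
  refine le_of_eq_of_le ?_ h3
  simp
  ring

/-- `B` is a convex set on which `f`, `η`, `q` are twice differentiable and compatible, with the
relevant derivatives bounded by `M`. -/
structure LocalBounds (f : State → State) (η q : State → ℝ) (B : Set State) (M : ℝ) : Prop where
  convex : Convex ℝ B
  contDiffAt_f : ∀ x ∈ B, ContDiffAt ℝ 2 f x
  contDiffAt_η : ∀ x ∈ B, ContDiffAt ℝ 2 η x
  contDiffAt_q : ∀ x ∈ B, ContDiffAt ℝ 2 q x
  compatible : ∀ x ∈ B, fderiv ℝ q x = (fderiv ℝ η x).comp (fderiv ℝ f x)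
  flux_symm : ∀ x ∈ B, ∀ y z : State, fderiv ℝ (fderiv ℝ η) x y (fderiv ℝ f x z)
    = fderiv ℝ (fderiv ℝ η) x z (fderiv ℝ f x y)
  symm : ∀ x ∈ B, ∀ y z : State, fderiv ℝ (fderiv ℝ η) x y z = fderiv ℝ (fderiv ℝ η) x z y
  norm_f' : ∀ x ∈ B, ‖fderiv ℝ f x‖ ≤ M
  norm_f'' : ∀ x ∈ B, ‖fderiv ℝ (fderiv ℝ f) x‖ ≤ M
  norm_η'' : ∀ x ∈ B, ‖fderiv ℝ (fderiv ℝ η) x‖ ≤ M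

namespace LocalBounds

variable {f : State → State} {η q : State → ℝ} {B : Set State} {M : ℝ}

lemma differentiableAt_f' (h : LocalBounds f η q B M) {x : State} (hx : x ∈ B) :
    DifferentiableAt ℝ (fderiv ℝ f) x :=
  ((h.contDiffAt_f x hx).fderiv_right (m := 1) (by norm_num)).differentiableAt (by norm_num)

lemma differentiableAt_η' (h : LocalBounds f η q B M) {x : State} (hx : x ∈ B) :
    DifferentiableAt ℝ (fderiv ℝ η) x :=
  ((h.contDiffAt_η x hx).fderiv_right (m := 1) (by norm_num)).differentiableAt (by norm_num)

lemma nonneg (h : LocalBounds f η q B M) {x : State} (hx : x ∈ B) : 0 ≤ M :=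
  (norm_nonneg _).trans (h.norm_f' x hx)

lemma norm_f'_sub_le (h : LocalBounds f η q B M) {x y : State} (hx : x ∈ B) (hy : y ∈ B) :
    ‖fderiv ℝ f y - fderiv ℝ f x‖ ≤ M * ‖y - x‖ :=
  h.convex.norm_image_sub_le_of_norm_fderiv_le (fun _ hz => h.differentiableAt_f' hz)
    h.norm_f'' hx hy

lemma norm_η'_sub_le (h : LocalBounds f η q B M) {x y : State} (hx : x ∈ B) (hy : y ∈ B) :
    ‖fderiv ℝ η y - fderiv ℝ η x‖ ≤ M * ‖y - x‖ :=
  h.convex.norm_image_sub_le_of_norm_fderiv_le (fun _ hz => h.differentiableAt_η' hz)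
    h.norm_η'' hx hy

lemma hasFDerivAt (h : LocalBounds f η q B M) {x : State} (hx : x ∈ B) (v : ℝ) (b : State) :
    HasFDerivAt (relSpeedFlux f η q v b)
      ((fderiv ℝ η x - fderiv ℝ η b).comp (fderiv ℝ f x - v • ContinuousLinearMap.id ℝ State))
      x :=
  hasFDerivAt_relSpeedFlux ((h.contDiffAt_f x hx).differentiableAt (by norm_num))
    ((h.contDiffAt_η x hx).differentiableAt (by norm_num))
    ((h.contDiffAt_q x hx).differentiableAt (by norm_num)) (h.compatible x hx) v b

lemma norm_sub_smul_id_le (A : State →L[ℝ] State) (v : ℝ) :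
    ‖A - v • ContinuousLinearMap.id ℝ State‖ ≤ ‖A‖ + |v| := by
  refine (norm_sub_le _ _).trans ?_
  rw [norm_smul, Real.norm_eq_abs]
  have := mul_le_mul_of_nonneg_left
    (ContinuousLinearMap.norm_id_le (𝕜 := ℝ) (E := State)) (abs_nonneg v)
  linarith

/-- The relative quantities are quadratic in the distance of the two states. -/
lemma relSpeedFlux_le (h : LocalBounds f η q B M) {a b : State} (ha : a ∈ B) (hb : b ∈ B)
    {v : ℝ} (hv : |v| ≤ M) : relSpeedFlux f η q v b a ≤ 2 * M ^ 2 * ‖a - b‖ ^ 2 := by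
  have hM := h.nonneg ha
  have hseg : segment ℝ b a ⊆ B := h.convex.segment_subset hb ha
  have := (convex_segment b a).norm_image_sub_le_of_norm_hasFDerivWithin_le
    (f := relSpeedFlux f η q v b) (C := (M * ‖a - b‖) * (2 * M))
    (fun x hx => (h.hasFDerivAt (hseg hx) v b).hasFDerivWithinAt)
    (fun x hx => by
      refine (ContinuousLinearMap.opNorm_comp_le _ _).trans ?_
      refine mul_le_mul ?_ ?_ (norm_nonneg _) (by positivity)
      · refine (h.norm_η'_sub_le hb (hseg hx)).trans (mul_le_mul_of_nonneg_left ?_ hM)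
        have := norm_sub_le_of_mem_segment hx
        rwa [norm_sub_rev x b, norm_sub_rev a b] at *
      · have := norm_sub_smul_id_le (fderiv ℝ f x) v
        have := h.norm_f' x (hseg hx)
        linarith)
    (left_mem_segment ℝ b a) (right_mem_segment ℝ b a)
  rw [relSpeedFlux_self, sub_zero] at this
  refine (le_abs_self _).trans (this.trans (le_of_eq ?_))
  ring

/-- Along a rarefaction curve, `∇η` changes to first order by left eigenvectors of `f' - λᵢ`, since
`∇²η rᵢ` is a left eigenvector. Hence the change is annihilated by `f'(u_L) - v` up to second
order. -/
lemma norm_gradient_sub_comp_le (h : LocalBounds f η q B M) {i : Fin 2} {uL : State} {s₀ : ℝ}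
    {R : ℝ → State} (hs₀ : 0 < s₀) (hR : IsRarefactionCurve f i uL s₀ R)
    (hRB : ∀ s ∈ Icc 0 s₀, R s ∈ B) (hRn : ∀ s ∈ Icc 0 s₀, ‖R s - uL‖ ≤ s) {v : ℝ}
    (hv : ∀ s ∈ Icc 0 s₀, |v - charSpeed f i (R s)| ≤ M * s₀) :
    ‖(fderiv ℝ η (R s₀) - fderiv ℝ η uL).comp
      (fderiv ℝ f uL - v • ContinuousLinearMap.id ℝ State)‖ ≤ 2 * M ^ 2 * s₀ ^ 2 := by
  obtain ⟨hR0, hR'⟩ := hR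
  choose! V hV hVd using hR'
  have h0 : (0 : ℝ) ∈ Icc 0 s₀ := left_mem_Icc.2 hs₀.le
  have huL : uL ∈ B := hR0 ▸ hRB 0 h0
  have hM := h.nonneg huL
  set Z := fderiv ℝ f uL - v • ContinuousLinearMap.id ℝ State with hZ
  have key := (convex_Icc 0 s₀).norm_image_sub_le_of_norm_hasDerivWithin_le
    (f := fun s => (fderiv ℝ η (R s)).comp Z)
    (f' := fun s => (fderiv ℝ (fderiv ℝ η) (R s) (V s)).comp Z) (C := 2 * M ^ 2 * s₀)
    (fun s hs => by
      have h1 := (h.differentiableAt_η' (hRB s hs)).hasFDerivAt.comp_hasDerivWithinAt s (hVd s hs)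
      have h2 := h1.clm_comp (hasDerivWithinAt_const s (Icc 0 s₀) Z)
      simpa using h2)
    (fun s hs => by
      have hRs := hRB s hs
      have hbound : ‖fderiv ℝ (fderiv ℝ η) (R s) (V s)‖ ≤ M := by
        refine (ContinuousLinearMap.le_opNorm _ _).trans ?_
        rw [(hV s hs).1, mul_one]
        exact h.norm_η'' _ hRs
      have heq : (fderiv ℝ (fderiv ℝ η) (R s) (V s)).comp Z
          = (fderiv ℝ (fderiv ℝ η) (R s) (V s)).comp ((fderiv ℝ f uL - fderiv ℝ f (R s))
            - (v - charSpeed f i (R s)) • ContinuousLinearMap.id ℝ State) := by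
        ext z
        have h1 := h.flux_symm _ hRs (V s) z
        rw [(hV s hs).2.1, map_smul, h.symm _ hRs z (V s)] at h1
        simp only [hZ, ContinuousLinearMap.comp_apply, sub_apply,
          smul_apply, ContinuousLinearMap.id_apply, map_sub, map_smul,
          smul_eq_mul] at h1 ⊢
        linarith
      rw [heq]
      refine (ContinuousLinearMap.opNorm_comp_le _ _).trans ?_
      have h3 := norm_sub_smul_id_le (fderiv ℝ f uL - fderiv ℝ f (R s))
        (v - charSpeed f i (R s))
      have h4 : ‖fderiv ℝ f uL - fderiv ℝ f (R s)‖ ≤ M * s₀ := by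
        refine (h.norm_f'_sub_le hRs huL).trans (mul_le_mul_of_nonneg_left ?_ hM)
        rw [norm_sub_rev]
        exact (hRn s hs).trans hs.2
      calc _ ≤ M * (M * s₀ + M * s₀) :=
            mul_le_mul hbound (by linarith [hv s hs]) (norm_nonneg _) hM
        _ = 2 * M ^ 2 * s₀ := by ring)
    h0 (right_mem_Icc.2 hs₀.le)
  rw [hR0, ← ContinuousLinearMap.sub_comp, sub_zero, Real.norm_eq_abs, abs_of_pos hs₀] at key
  refine key.trans (le_of_eq ?_)
  ring

/-- The combination `F(·;u_R) - θ F(·;u_L)` of relative fluxes is bounded by `s₀²` wherever its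
Hessian is nonpositive: it is then below its tangent at `u_L`, and its value and gradient at `u_L`
are of order `s₀²`. -/
lemma relSpeedFlux_sub_le (h : LocalBounds f η q B M) {i : Fin 2} {uL : State} {s₀ : ℝ}
    {R : ℝ → State} (hs₀ : 0 < s₀) (hR : IsRarefactionCurve f i uL s₀ R)
    (hRB : ∀ s ∈ Icc 0 s₀, R s ∈ B) (hRn : ∀ s ∈ Icc 0 s₀, ‖R s - uL‖ ≤ s) {v θ : ℝ}
    (hvM : |v| ≤ M) (hv : ∀ s ∈ Icc 0 s₀, |v - charSpeed f i (R s)| ≤ M * s₀)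
    (hneg : ∀ x ∈ B, ∀ z : State,
      (1 - θ) * (fderiv ℝ (fderiv ℝ η) x z (fderiv ℝ f x z - v • z)
        + (fderiv ℝ η x - fderiv ℝ η uL) (fderiv ℝ (fderiv ℝ f) x z z))
        - (fderiv ℝ η (R s₀) - fderiv ℝ η uL) (fderiv ℝ (fderiv ℝ f) x z z) ≤ 0)
    {w : State} (hw : w ∈ B) (hwL : ‖w - uL‖ ≤ 1) :
    relSpeedFlux f η q v (R s₀) w - θ * relSpeedFlux f η q v uL w ≤ 4 * M ^ 2 * s₀ ^ 2 := by
  have h0 : (0 : ℝ) ∈ Icc 0 s₀ := left_mem_Icc.2 hs₀.le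
  have h1 : s₀ ∈ Icc 0 s₀ := right_mem_Icc.2 hs₀.le
  have huL : uL ∈ B := hR.1 ▸ hRB 0 h0
  set uR := R s₀ with huRdef
  have huR : uR ∈ B := hRB s₀ h1
  set z := w - uL with hz
  have hline : ∀ t ∈ Icc (0 : ℝ) 1, uL + t • z ∈ B := by
    intro t ht
    have := h.convex.add_smul_sub_mem huL hw ht
    simpa [hz] using this
  have hd : ∀ b : State, ∀ t ∈ Icc (0 : ℝ) 1,
      HasDerivAt (fun t : ℝ => relSpeedFlux f η q v b (uL + t • z))
        ((fderiv ℝ η (uL + t • z) - fderiv ℝ η b) (fderiv ℝ f (uL + t • z) z - v • z)) t := by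
    intro b t ht
    have hx : HasDerivAt (fun t : ℝ => uL + t • z) z t := by
      simpa using ((hasDerivAt_id t).smul_const z).const_add uL
    exact (h.hasFDerivAt (hline t ht) v b).comp_hasDerivAt t hx
  have key := le_tangent
    (fun t ht => (hd uR t ht).sub ((hd uL t ht).const_mul θ))
    (fun t ht => (hasDerivAt_relSpeedFlux_deriv (h.differentiableAt_f' (hline t ht))
      (h.differentiableAt_η' (hline t ht)) v uR).sub
      ((hasDerivAt_relSpeedFlux_deriv (h.differentiableAt_f' (hline t ht))
      (h.differentiableAt_η' (hline t ht)) v uL).const_mul θ))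
    (fun t ht => by
      have := hneg _ (hline t ht) z
      refine le_of_eq_of_le ?_ this
      simp only [sub_apply]
      ring)
  have hgrad : (fderiv ℝ η uL - fderiv ℝ η uR) (fderiv ℝ f uL z - v • z)
      ≤ 2 * M ^ 2 * s₀ ^ 2 := by
    have e1 := h.norm_gradient_sub_comp_le hs₀ hR hRB hRn hv
    have e2 : (fderiv ℝ η uL - fderiv ℝ η uR) (fderiv ℝ f uL z - v • z)
        = -((fderiv ℝ η (R s₀) - fderiv ℝ η uL).comp
      (fderiv ℝ f uL - v • ContinuousLinearMap.id ℝ State)) z := by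
      simp only [ContinuousLinearMap.comp_apply, sub_apply,
          smul_apply, ContinuousLinearMap.id_apply, ← huRdef]
      ring
    rw [e2]
    refine (neg_le_abs _).trans ?_
    rw [← Real.norm_eq_abs]
    refine (ContinuousLinearMap.le_opNorm _ _).trans ?_
    calc _ ≤ 2 * M ^ 2 * s₀ ^ 2 * 1 := mul_le_mul e1 hwL (norm_nonneg _) (by positivity)
      _ = _ := mul_one _
  have hval : relSpeedFlux f η q v uR uL ≤ 2 * M ^ 2 * s₀ ^ 2 := by
    refine (h.relSpeedFlux_le huL huR hvM).trans ?_
    have : ‖uL - uR‖ ≤ s₀ := by rw [norm_sub_rev]; exact hRn s₀ h1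
    gcongr
  simp only [Pi.sub_apply, one_smul, zero_smul, add_zero, relSpeedFlux_self, mul_zero, sub_zero,
    sub_self, zero_apply] at key
  have hw' : uL + z = w := by rw [hz]; abel
  rw [hw'] at key
  linarith

end LocalBounds

lemma contDiffAt_of_satisfiesGL {f : State → State} {d : State} (h : SatisfiesGL f d) :
    ContDiffAt ℝ 4 f d := by
  obtain ⟨r, hr, hf, -⟩ := h
  exact hf.contDiffAt (Metric.ball_mem_nhds d hr)

lemma eventually_norm_le_of_continuousAt {E : Type*} [NormedAddCommGroup E] {g : State → E} {d : State}
    (hg : ContinuousAt g d) {M : ℝ} (hM : ‖g d‖ < M) : ∀ᶠ x in 𝓝 d, ‖g x‖ ≤ M :=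
  (hg.norm.eventually (gt_mem_nhds hM)).mono fun _ hx => le_of_lt hx

set_option maxHeartbeats 1000000 in
/-- The contribution of a single state: for suitable weights, `F(w;u_R) - (a₁/a₂) F(w;u_L)` is at
most quadratic in the strength of the rarefaction, for all `w` near `d` and all speeds `v` inside
the fan. -/
theorem exists_pointwise_bound {f : State → State} {d : State} (hGL : SatisfiesGL f d)
    {W : Set State} (hW : IsOpen W) (hdW : d ∈ W) {η q : State → ℝ}
    (hη : IsConvexEntropyPair f W η q) (i : Fin 2) :
    ∃ C₀ > 0, ∀ C₂ ≥ C₀, ∃ K > 0, ∀ᶠ ε in 𝓝[>] (0 : ℝ),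
      ∀ (uL uR : State) (s₀ : ℝ) (R : ℝ → State),
      ‖uL - d‖ + ‖uR - d‖ ≤ ε → 0 < s₀ → IsRarefactionCurve f i uL s₀ R → R s₀ = uR →
      ∀ a₁ a₂ : ℝ, AdmissibleWeights i C₂ s₀ a₁ a₂ →
      ∀ v ∈ uIcc (charSpeed f i uL) (charSpeed f i uR), ∀ w ∈ Metric.closedBall d ε,
        relSpeedFlux f η q v uR w - a₁ / a₂ * relSpeedFlux f η q v uL w
          ≤ K * (charSpeed f i uL - charSpeed f i uR) ^ 2 := by
  have hf4 := contDiffAt_of_satisfiesGL hGL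
  have hf2 : ContDiffAt ℝ 2 f d := hf4.of_le (by norm_num)
  have hηd : ContDiffAt ℝ 3 η d := hη.contDiffOn_entropy.contDiffAt (hW.mem_nhds hdW)
  have hqd : ContDiffAt ℝ 3 q d := hη.contDiffOn_flux.contDiffAt (hW.mem_nhds hdW)
  have hd : 0 < disc (fderiv ℝ f d) := disc_pos_of_strictlyHyperbolicAt hGL.choose_spec.2.2.1
  obtain ⟨r, hr⟩ := exists_isCharVector hd i (hGL.choose_spec.2.2.2 i)
  obtain ⟨C₀, hC₀, hC₀'⟩ := exists_weight hW hdW hη hf2 hd i hr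
  refine ⟨2 * C₀, by positivity, fun C₂ hC₂ => ?_⟩
  have htube := eventually_quadratic_neg (C := C₂ / 2) hf4 hηd
    (fun c hc => hC₀' c (by linarith)) (2 * C₂)
  obtain ⟨δ, hδ, htube⟩ := Metric.eventually_nhds_iff_ball.1 htube
  obtain ⟨c, hc, hloc⟩ := rarefactionCurve_local hf2 hd i hr
  have f1 : ContDiffAt ℝ 3 (fderiv ℝ f) d := hf4.fderiv_right (by norm_num)
  have f2 : ContDiffAt ℝ 2 (fderiv ℝ (fderiv ℝ f)) d := f1.fderiv_right (by norm_num)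
  have e1 : ContDiffAt ℝ 2 (fderiv ℝ η) d := hηd.fderiv_right (by norm_num)
  have e2 : ContDiffAt ℝ 1 (fderiv ℝ (fderiv ℝ η)) d := e1.fderiv_right (by norm_num)
  have hlam := contDiffAt_charSpeed hf2 hd i
  obtain ⟨Lip, S, hS, hLip⟩ := hlam.exists_lipschitzOnWith
  have cp : ∀ᶠ z : State × State in 𝓝 (d, r),
      dist (fderiv ℝ (fderiv ℝ η) z.1 z.2) (fderiv ℝ (fderiv ℝ η) d r) < δ / 2 := by
    have : ContinuousAt (fun z : State × State => fderiv ℝ (fderiv ℝ η) z.1 z.2) (d, r) :=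
      ContinuousAt.clm_apply (ContinuousAt.comp (g := fderiv ℝ (fderiv ℝ η))
        (f := fun z : State × State => z.1) e2.continuousAt continuousAt_fst) continuousAt_snd
    exact this.eventually (Metric.ball_mem_nhds _ (by positivity))
  set M : ℝ := ‖fderiv ℝ f d‖ + ‖fderiv ℝ (fderiv ℝ f) d‖ + ‖fderiv ℝ (fderiv ℝ η) d‖
    + ‖charSpeed f i d‖ + Lip + 1 with hMdef
  have n1 := norm_nonneg (fderiv ℝ f d)
  have n2 := norm_nonneg (fderiv ℝ (fderiv ℝ f) d)
  have n3 := norm_nonneg (fderiv ℝ (fderiv ℝ η) d)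
  have n4 := norm_nonneg (charSpeed f i d)
  have n5 : (0 : ℝ) ≤ Lip := Lip.2
  have hMpos : 0 < M := by linarith
  have hev : ∀ᶠ x in 𝓝 d, (ContDiffAt ℝ 4 f x ∧ x ∈ W ∧ x ∈ S ∧
      dist (charSpeed f i x) (charSpeed f i d) < δ / 2) ∧
      (‖fderiv ℝ f x‖ ≤ M ∧ ‖fderiv ℝ (fderiv ℝ f) x‖ ≤ M ∧ ‖fderiv ℝ (fderiv ℝ η) x‖ ≤ M ∧
        ‖charSpeed f i x‖ ≤ M) ∧
      ∀ v, IsCharVector f i x v →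
        dist (fderiv ℝ (fderiv ℝ η) x v) (fderiv ℝ (fderiv ℝ η) d r) < δ / 2 := by
    refine Filter.Eventually.and ?_ (Filter.Eventually.and ?_ ?_)
    · exact (hf4.eventually (by simp)).and (Filter.Eventually.and (hW.mem_nhds hdW)
        (Filter.Eventually.and hS
        (hlam.continuousAt.eventually (Metric.ball_mem_nhds _ (by positivity)))))
    · exact (eventually_norm_le_of_continuousAt f1.continuousAt (by linarith)).and
        ((eventually_norm_le_of_continuousAt f2.continuousAt (by linarith)).and
        ((eventually_norm_le_of_continuousAt e2.continuousAt (by linarith)).and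
        (eventually_norm_le_of_continuousAt hlam.continuousAt (by linarith))))
    · exact eventually_of_isCharVector hf2 hd i hr cp
  obtain ⟨ρ₀, hρ₀, hball⟩ := Metric.eventually_nhds_iff_ball.1 hev
  set ρ := min ρ₀ (min (δ / 2) (1 / 2)) with hρdef
  have hρ : 0 < ρ := lt_min hρ₀ (lt_min (by positivity) (by norm_num))
  have hρρ₀ : ρ ≤ ρ₀ := min_le_left _ _
  have hρδ : ρ ≤ δ / 2 := (min_le_right _ _).trans (min_le_left _ _)
  have hρ1 : ρ ≤ 1 / 2 := (min_le_right _ _).trans (min_le_right _ _)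
  have hb : ∀ x ∈ Metric.ball d ρ, x ∈ Metric.ball d ρ₀ := fun x hx =>
    Metric.ball_subset_ball hρρ₀ hx
  have hLB : LocalBounds f η q (Metric.ball d ρ) M :=
    { convex := convex_ball d ρ
      contDiffAt_f := fun x hx => (hball x (hb x hx)).1.1.of_le (by norm_num)
      contDiffAt_η := fun x hx => (hη.contDiffOn_entropy.contDiffAt
        (hW.mem_nhds (hball x (hb x hx)).1.2.1)).of_le (by norm_num)
      contDiffAt_q := fun x hx => (hη.contDiffOn_flux.contDiffAt
        (hW.mem_nhds (hball x (hb x hx)).1.2.1)).of_le (by norm_num)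
      compatible := fun x hx => hη.compatible x (hball x (hb x hx)).1.2.1
      flux_symm := fun x hx => hessian_flux_symm hW hη (hball x (hb x hx)).1.2.1
        ((hball x (hb x hx)).1.1.of_le (by norm_num))
      symm := fun x hx => hessian_symm ((hη.contDiffOn_entropy.contDiffAt
        (hW.mem_nhds (hball x (hb x hx)).1.2.1)).of_le (by norm_num))
      norm_f' := fun x hx => (hball x (hb x hx)).2.1.1
      norm_f'' := fun x hx => (hball x (hb x hx)).2.1.2.1
      norm_η'' := fun x hx => (hball x (hb x hx)).2.1.2.2.1 }
  refine ⟨4 * M ^ 2 / c ^ 2, by positivity, ?_⟩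
  have hερ : ∀ᶠ ε in 𝓝[>] (0 : ℝ), ε < ρ := nhdsWithin_le_nhds (gt_mem_nhds hρ)
  filter_upwards [hloc ρ hρ, hερ] with ε hloc hερ uL uR s₀ R hLR hs₀ hR hRs a₁ a₂ ha v hv w hw
  obtain ⟨hRB, hcs, hspeed, hRn⟩ := hloc uL uR s₀ R hLR hs₀ hR hRs
  have h0 : (0 : ℝ) ∈ Icc 0 s₀ := left_mem_Icc.2 hs₀.le
  have h1 : s₀ ∈ Icc 0 s₀ := right_mem_Icc.2 hs₀.le
  have huL : uL ∈ Metric.ball d ρ := hR.1 ▸ hRB 0 h0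
  have huR : uR ∈ Metric.ball d ρ := hRs ▸ hRB s₀ h1
  have hwB : w ∈ Metric.ball d ρ := Metric.closedBall_subset_ball hερ hw
  have hle : charSpeed f i uL ≤ charSpeed f i uR := by nlinarith
  rw [uIcc_of_le hle] at hv
  obtain ⟨k, hk, hkθ⟩ := exists_eq_of_admissibleWeights hs₀ ha
  have hΔ : charSpeed f i uR - charSpeed f i uL ≤ M * s₀ := by
    have h5 := hLip.norm_sub_le (hball uR (hb _ huR)).1.2.2.1 (hball uL (hb _ huL)).1.2.2.1
    have h6 : ‖uR - uL‖ ≤ s₀ := hRs ▸ hRn s₀ h1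
    refine (le_abs_self _).trans (h5.trans (mul_le_mul ?_ h6 (norm_nonneg _) hMpos.le))
    linarith
  have bL := (hball uL (hb _ huL)).1.2.2.2
  have bR := (hball uR (hb _ huR)).1.2.2.2
  rw [Real.dist_eq, abs_lt] at bL bR
  have hvδ : dist v (charSpeed f i d) < δ / 2 := by
    rw [Real.dist_eq, abs_lt]; constructor <;> linarith [hv.1, hv.2]
  have hvM : |v| ≤ M := by
    have mL := abs_le.1 (hball uL (hb _ huL)).2.1.2.2.2
    have mR := abs_le.1 (hball uR (hb _ huR)).2.1.2.2.2
    rw [abs_le]; constructor <;> linarith [hv.1, hv.2]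
  -- the normalized increment of `∇η` along the curve is close to `∇²η(d) rᵢ(d)`
  have hp : dist (s₀⁻¹ • (fderiv ℝ η (R s₀) - fderiv ℝ η uL)) (fderiv ℝ (fderiv ℝ η) d r) < δ := by
    set p₀ := fderiv ℝ (fderiv ℝ η) d r
    have hR' := hR.2
    choose! V hV hVd using hR'
    have := (convex_Icc 0 s₀).norm_image_sub_le_of_norm_hasDerivWithin_le
      (f := fun s => fderiv ℝ η (R s) - s • p₀)
      (f' := fun s => fderiv ℝ (fderiv ℝ η) (R s) (V s) - (1 : ℝ) • p₀) (C := δ / 2)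
      (fun s hs => ((hLB.differentiableAt_η' (hRB s hs)).hasFDerivAt.comp_hasDerivWithinAt s
        (hVd s hs)).sub ((hasDerivWithinAt_id s _).smul_const p₀))
      (fun s hs => by
        have := (hball _ (hb _ (hRB s hs))).2.2 (V s) (hV s hs)
        rw [dist_eq_norm] at this
        rw [one_smul]
        exact this.le) h0 h1
    rw [hR.1, zero_smul, sub_zero, sub_zero, Real.norm_eq_abs, abs_of_pos hs₀] at this
    have e : s₀⁻¹ • (fderiv ℝ η (R s₀) - fderiv ℝ η uL) - p₀
        = s₀⁻¹ • (fderiv ℝ η (R s₀) - s₀ • p₀ - fderiv ℝ η uL) := by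
      rw [smul_sub, smul_sub, smul_sub, smul_smul, inv_mul_cancel₀ hs₀.ne', one_smul]
      abel
    rw [dist_eq_norm, e, norm_smul, norm_inv, Real.norm_eq_abs, abs_of_pos hs₀]
    calc s₀⁻¹ * _ ≤ s₀⁻¹ * (δ / 2 * s₀) := mul_le_mul_of_nonneg_left this (by positivity)
      _ = δ / 2 := by field_simp
      _ < δ := by linarith
  have hfin := hLB.relSpeedFlux_sub_le (θ := a₁ / a₂) hs₀ hR hRB hRn hvM
    (fun s hs => by
      have := hspeed s hs
      rw [abs_le]; constructor <;> linarith [hv.1, hv.2])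
    (fun x hx z => by
      have hY := htube (s₀⁻¹ • (fderiv ℝ η (R s₀) - fderiv ℝ η uL), uL, v, x) (by
        rw [Metric.mem_ball, Prod.dist_eq, Prod.dist_eq, Prod.dist_eq]
        refine max_lt hp (max_lt ?_ (max_lt ?_ ?_))
        · exact (Metric.mem_ball.1 huL).trans_le (by linarith)
        · exact hvδ.trans (by linarith)
        · exact (Metric.mem_ball.1 hx).trans_le (by linarith)) k hk z
      have hY' := mul_nonpos_of_nonneg_of_nonpos hs₀.le hY
      refine le_of_eq_of_le ?_ hY'
      rw [hkθ]
      simp only [smul_apply, smul_eq_mul]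
      field_simp)
    hwB (by
      have a := mem_ball_iff_norm.1 hwB
      have b := mem_ball_iff_norm.1 huL
      have : w - uL = (w - d) - (uL - d) := by abel
      rw [this]; exact (norm_sub_le _ _).trans (by linarith))
  rw [hRs] at hfin
  refine hfin.trans ?_
  rw [div_mul_eq_mul_div, le_div_iff₀ (by positivity)]
  have h7 : (c * s₀) ^ 2 ≤ (charSpeed f i uR - charSpeed f i uL) ^ 2 :=
    pow_le_pow_left₀ (by positivity) hcs 2
  nlinarith [mul_le_mul_of_nonneg_left h7 (by positivity : (0 : ℝ) ≤ 4 * M ^ 2)]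

/-! ### Test functions -/

lemma isOpen_timeInterval (T : EReal) : IsOpen (timeInterval T) :=
  (isOpen_lt continuous_const continuous_id).inter
    (isOpen_lt continuous_coe_real_ereal continuous_const)

lemma isOpen_strip (T : EReal) : IsOpen (strip T) :=
  (isOpen_timeInterval T).preimage continuous_fst

lemma strip_eq_prod (T : EReal) : strip T = timeInterval T ×ˢ univ := by
  ext p; simp [strip]

lemma volume_restrict_strip (T : EReal) :
    (volume : Measure (ℝ × ℝ)).restrict (strip T)
      = (volume.restrict (timeInterval T)).prod volume := by
  rw [strip_eq_prod, Measure.volume_eq_prod, ← Measure.prod_restrict, Measure.restrict_univ]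

lemma Ioo_subset_timeInterval {T : EReal} {b : ℝ} (hb : (b : EReal) ≤ T) :
    Ioo 0 b ⊆ timeInterval T := fun _ ht =>
  ⟨ht.1, (EReal.coe_lt_coe_iff.2 ht.2).trans_le hb⟩

namespace IsTest

variable {T : EReal} {φ ψ : ℝ × ℝ → ℝ}

lemma differentiable (h : IsTest T φ) : Differentiable ℝ φ := h.smooth.differentiable (by simp)

lemma add (hφ : IsTest T φ) (hψ : IsTest T ψ) : IsTest T (φ + ψ) :=
  ⟨hφ.smooth.add hψ.smooth, hφ.compact.add hψ.compact,
    (tsupport_add φ ψ).trans (union_subset hφ.support_subset hψ.support_subset)⟩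

lemma smul (c : ℝ) (hφ : IsTest T φ) : IsTest T (c • φ) :=
  ⟨hφ.smooth.const_smul c, hφ.compact.smul_left (f := fun _ => c),
    (tsupport_smul_subset_right (fun _ => c) φ).trans hφ.support_subset⟩

lemma zero (T : EReal) : IsTest T 0 :=
  ⟨contDiff_const, HasCompactSupport.zero, by simp [tsupport]⟩

lemma continuous_fderiv (h : IsTest T φ) : Continuous (fderiv ℝ φ) :=
  h.smooth.continuous_fderiv (by simp)

lemma integrable_dt (h : IsTest T φ) : Integrable (dt φ) := by
  have hc : Continuous (dt φ) := h.continuous_fderiv.clm_apply continuous_const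
  exact hc.integrable_of_hasCompactSupport (h.compact.fderiv_apply ℝ (1, 0))

lemma integrable_dx (h : IsTest T φ) : Integrable (dx φ) := by
  have hc : Continuous (dx φ) := h.continuous_fderiv.clm_apply continuous_const
  exact hc.integrable_of_hasCompactSupport (h.compact.fderiv_apply ℝ (0, 1))

lemma integrable_pairing (h : IsTest T φ) {a b : ℝ × ℝ → ℝ} {M : ℝ} (ha : Measurable a)
    (hb : Measurable b) (haM : ∀ p, |a p| ≤ M) (hbM : ∀ p, |b p| ≤ M) :
    Integrable (fun p => dt φ p * a p + dx φ p * b p) := by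
  refine Integrable.add ?_ ?_
  · exact h.integrable_dt.mul_bdd (c := M) ha.aestronglyMeasurable (Eventually.of_forall haM)
  · exact h.integrable_dx.mul_bdd (c := M) hb.aestronglyMeasurable (Eventually.of_forall hbM)

lemma dt_add (hφ : IsTest T φ) (hψ : IsTest T ψ) (p : ℝ × ℝ) :
    dt (φ + ψ) p = dt φ p + dt ψ p := by
  simp [dt, fderiv_add (hφ.differentiable p) (hψ.differentiable p)]

lemma dx_add (hφ : IsTest T φ) (hψ : IsTest T ψ) (p : ℝ × ℝ) :
    dx (φ + ψ) p = dx φ p + dx ψ p := by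
  simp [dx, fderiv_add (hφ.differentiable p) (hψ.differentiable p)]

lemma dt_smul (c : ℝ) (hφ : IsTest T φ) (p : ℝ × ℝ) : dt (c • φ) p = c * dt φ p := by
  simp [dt, fderiv_const_smul (hφ.differentiable p)]

lemma dx_smul (c : ℝ) (hφ : IsTest T φ) (p : ℝ × ℝ) : dx (c • φ) p = c * dx φ p := by
  simp [dx, fderiv_const_smul (hφ.differentiable p)]

lemma eq_zero_of_notMem (hφ : IsTest T φ) {p : ℝ × ℝ} (hp : p ∉ strip T) : φ p = 0 :=
  image_eq_zero_of_notMem_tsupport fun h => hp (hφ.support_subset h)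

end IsTest

lemma exists_isTest_eq_one {T : EReal} {K : Set (ℝ × ℝ)} (hK : IsCompact K) (hKT : K ⊆ strip T) :
    ∃ φ, IsTest T φ ∧ (∀ p, 0 ≤ φ p) ∧ ∀ p ∈ K, φ p = 1 := by
  obtain ⟨L, hL, hKL, hLT⟩ := exists_compact_between hK (isOpen_strip T) hKT
  obtain ⟨φ, hφ, hr, hs, h1⟩ := exists_contMDiff_support_eq_eq_one_iff (n := ⊤)
    (modelWithCornersSelf ℝ (ℝ × ℝ)) isOpen_interior hK.isClosed hKL
  have hsub : tsupport φ ⊆ L := by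
    rw [tsupport, hs]
    exact closure_minimal interior_subset hL.isClosed
  exact ⟨φ, ⟨hφ.contDiff, hL.of_isClosed_subset (isClosed_tsupport φ) hsub, hsub.trans hLT⟩,
    fun p => (hr (mem_range_self p)).1, fun p hp => (h1 p).1 hp⟩

/-! ### Nonnegative distributions are measures -/

open scoped CompactlySupported in
/-- A nonnegative linear functional on the test functions of the open strip is integration against
a measure. The functional extends to a positive functional on `C_c` by M. Riesz' extension theorem,
since every function in `C_c` is dominated by a test function, and the extension is represented by
the Riesz–Markov–Kakutani theorem. -/
theorem exists_measure_of_nonneg_functional {T : EReal} (Λ : (ℝ × ℝ → ℝ) → ℝ)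
    (hadd : ∀ φ ψ, IsTest T φ → IsTest T ψ → Λ (φ + ψ) = Λ φ + Λ ψ)
    (hsmul : ∀ (c : ℝ) φ, IsTest T φ → Λ (c • φ) = c * Λ φ)
    (hpos : ∀ φ, IsTest T φ → (∀ p, 0 ≤ φ p) → 0 ≤ Λ φ) :
    ∃ m : Measure (ℝ × ℝ), m (strip T)ᶜ = 0 ∧
      ∀ φ, IsTest T φ → Integrable φ m ∧ ∫ p, φ p ∂m = Λ φ := by
  classical
  have hopen := isOpen_strip T
  have : LocallyCompactSpace (strip T) := hopen.locallyCompactSpace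
  -- extension of functions on the strip by zero
  let ext : C_c(strip T, ℝ) → ℝ × ℝ → ℝ := fun y p => if h : p ∈ strip T then y ⟨p, h⟩ else 0
  have ext_add : ∀ y z, ext (y + z) = ext y + ext z := by
    intro y z; funext p
    by_cases h : p ∈ strip T <;> simp [ext, h]
  have ext_smul : ∀ (c : ℝ) y, ext (c • y) = c • ext y := by
    intro c y; funext p
    by_cases h : p ∈ strip T <;> simp [ext, h]
  have ext_zero : ext 0 = 0 := by
    funext p
    by_cases h : p ∈ strip T <;> simp [ext, h]
  -- restriction of a test function to the strip
  have hres : ∀ φ, IsTest T φ → ∃ y : C_c(strip T, ℝ), (∀ p, y p = φ p) ∧ ext y = φ := by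
    intro φ hφ
    refine ⟨⟨⟨fun p => φ p, hφ.smooth.continuous.comp continuous_subtype_val⟩, ?_⟩, fun p => rfl, ?_⟩
    · refine HasCompactSupport.of_support_subset_isCompact
        (K := Subtype.val ⁻¹' tsupport φ) ?_ ?_
      · rw [Topology.IsInducing.subtypeVal.isCompact_preimage_iff]
        · exact hφ.compact
        · rw [Subtype.range_coe]; exact hφ.support_subset
      · intro p hp
        exact subset_tsupport φ hp
    · funext p
      by_cases h : p ∈ strip T
      · simp [ext, h]
      · simp [ext, h, hφ.eq_zero_of_notMem h]
  let D : Submodule ℝ C_c(strip T, ℝ) :=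
    { carrier := {y | IsTest T (ext y)}
      add_mem' := fun {y z} hy hz => by
        change IsTest T (ext (y + z))
        rw [ext_add]; exact hy.add hz
      zero_mem' := by
        change IsTest T (ext 0)
        rw [ext_zero]; exact IsTest.zero T
      smul_mem' := fun c y hy => by
        change IsTest T (ext (c • y))
        rw [ext_smul]; exact hy.smul c }
  let F : C_c(strip T, ℝ) →ₗ.[ℝ] ℝ :=
    { domain := D
      toFun :=
        { toFun := fun y => Λ (ext y)
          map_add' := fun y z => by
            change Λ (ext (y + z)) = _
            rw [ext_add]; exact hadd _ _ y.2 z.2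
          map_smul' := fun c y => by
            change Λ (ext (c • (y : C_c(strip T, ℝ)))) = _
            rw [ext_smul]; exact hsmul _ _ y.2 } }
  let S : PointedCone ℝ C_c(strip T, ℝ) :=
    { carrier := {y | ∀ p, 0 ≤ y p}
      add_mem' := fun {y z} hy hz p => add_nonneg (hy p) (hz p)
      zero_mem' := fun p => le_rfl
      smul_mem' := fun c y hy p => mul_nonneg c.2 (hy p) }
  obtain ⟨g, hg, hgpos⟩ := riesz_extension S F
    (fun y hy => hpos _ y.2 fun p => by
      by_cases h : p ∈ strip T
      · simpa [ext, h] using hy ⟨p, h⟩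
      · simp [ext, h])
    (fun y => by
      have hK : IsCompact (Subtype.val '' tsupport y) :=
        y.hasCompactSupport.isCompact.image continuous_subtype_val
      obtain ⟨φ, hφ, hφ0, hφ1⟩ := exists_isTest_eq_one (T := T) hK (by
        rintro _ ⟨p, -, rfl⟩; exact p.2)
      obtain ⟨M, hM⟩ := y.hasCompactSupport.exists_bound_of_continuous y.continuous
      obtain ⟨z, hz, hzext⟩ := hres (|M| • φ) (hφ.smul |M|)
      refine ⟨⟨z, by change IsTest T (ext z); rw [hzext]; exact hφ.smul |M|⟩, fun p => ?_⟩
      change 0 ≤ z p + y p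
      rw [hz]
      by_cases hp : p ∈ tsupport y
      · have h1 := hφ1 p ⟨p, hp, rfl⟩
        have h2 := abs_le.1 (hM p)
        have h3 := le_abs_self M
        simp only [Pi.smul_apply, h1, smul_eq_mul]
        linarith [h2.1]
      · rw [image_eq_zero_of_notMem_tsupport hp]
        simp only [Pi.smul_apply, smul_eq_mul, add_zero]
        exact mul_nonneg (abs_nonneg M) (hφ0 p))
  let Λ' : C_c(strip T, ℝ) →ₚ[ℝ] ℝ := PositiveLinearMap.mk₀ g fun y hy => hgpos y hy
  have hemb : MeasurableEmbedding (Subtype.val : strip T → ℝ × ℝ) :=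
    MeasurableEmbedding.subtype_coe hopen.measurableSet
  refine ⟨(RealRMK.rieszMeasure Λ').map Subtype.val, ?_, fun φ hφ => ?_⟩
  · rw [hemb.map_apply]
    convert measure_empty (μ := RealRMK.rieszMeasure Λ')
    ext p
    simp
  · obtain ⟨y, hy, hyext⟩ := hres φ hφ
    have hyφ : φ ∘ Subtype.val = y := by funext p; exact (hy p).symm
    constructor
    · rw [hemb.integrable_map_iff, hyφ]
      exact y.continuous.integrable_of_hasCompactSupport y.hasCompactSupport
    · rw [hemb.integral_map]
      have h1 := RealRMK.integral_rieszMeasure Λ' y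
      simp only [hy] at h1
      rw [h1]
      have h2 := hg ⟨y, by change IsTest T (ext y); rwa [hyext]⟩
      have h3 : Λ' y = g y := rfl
      rw [h3, h2]
      change Λ (ext y) = Λ φ
      rw [hyext]

/-! ### Cut-off functions -/

/-- A smooth cut-off of the interval `(0,b)`, equal to one at distance at least `2/k` from its
ends and to zero at distance at most `1/k`. -/
noncomputable def cutoff (b k t : ℝ) : ℝ :=
  Real.smoothTransition (k * t - 1) * Real.smoothTransition (k * (b - t) - 1)

lemma cutoff_nonneg (b k t : ℝ) : 0 ≤ cutoff b k t :=
  mul_nonneg (Real.smoothTransition.nonneg _) (Real.smoothTransition.nonneg _)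

lemma cutoff_le_one (b k t : ℝ) : cutoff b k t ≤ 1 :=
  mul_le_one₀ (Real.smoothTransition.le_one _) (Real.smoothTransition.nonneg _)
    (Real.smoothTransition.le_one _)

lemma contDiff_cutoff (b k : ℝ) : ContDiff ℝ ∞ (cutoff b k) := by
  unfold cutoff
  exact (Real.smoothTransition.contDiff.comp (by fun_prop)).mul
    (Real.smoothTransition.contDiff.comp (by fun_prop))

lemma cutoff_eq_one {b k t : ℝ} (h1 : 2 ≤ k * t) (h2 : 2 ≤ k * (b - t)) : cutoff b k t = 1 := by
  unfold cutoff
  rw [Real.smoothTransition.one_of_one_le (by linarith),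
    Real.smoothTransition.one_of_one_le (by linarith), one_mul]

lemma support_cutoff_subset {k : ℝ} (hk : 0 < k) (b : ℝ) :
    Function.support (cutoff b k) ⊆ Icc (1 / k) (b - 1 / k) := by
  intro t ht
  have h1 : 0 < k * t - 1 := by
    by_contra! h
    exact ht (by unfold cutoff; rw [Real.smoothTransition.zero_of_nonpos h, zero_mul])
  have h2 : 0 < k * (b - t) - 1 := by
    by_contra! h
    exact ht (by unfold cutoff; rw [Real.smoothTransition.zero_of_nonpos h, mul_zero])
  constructor
  · rw [div_le_iff₀ hk]; linarith
  · have : 1 / k ≤ b - t := by rw [div_le_iff₀ hk]; linarith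
    linarith

lemma Icc_subset_Ioo_of_pos {k : ℝ} (hk : 0 < k) (b : ℝ) :
    Icc (1 / k) (b - 1 / k) ⊆ Ioo 0 b := by
  have : 0 < 1 / k := by positivity
  exact fun t ht => ⟨by linarith [ht.1], by linarith [ht.2]⟩

lemma tendsto_cutoff {b t : ℝ} (ht : t ∈ Ioo 0 b) :
    Tendsto (fun k : ℕ => cutoff b k t) atTop (𝓝 1) := by
  refine tendsto_const_nhds.congr' ?_
  have h1 : Tendsto (fun k : ℕ => (k : ℝ) * t) atTop atTop :=
    tendsto_natCast_atTop_atTop.atTop_mul_const ht.1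
  have h2 : Tendsto (fun k : ℕ => (k : ℝ) * (b - t)) atTop atTop :=
    tendsto_natCast_atTop_atTop.atTop_mul_const (sub_pos.2 ht.2)
  filter_upwards [h1.eventually_ge_atTop 2, h2.eventually_ge_atTop 2] with k hk1 hk2
  exact (cutoff_eq_one hk1 hk2).symm

lemma hasCompactSupport_deriv_smoothTransition :
    HasCompactSupport (deriv Real.smoothTransition) := by
  refine HasCompactSupport.of_support_subset_isCompact (isCompact_Icc (a := (0 : ℝ)) (b := 1)) ?_
  intro x hx
  by_contra hn
  apply hx
  rw [mem_Icc, not_and_or, not_le, not_le] at hn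
  rcases hn with h | h
  · have : Real.smoothTransition =ᶠ[𝓝 x] fun _ => 0 := by
      filter_upwards [gt_mem_nhds h] with y hy
      exact Real.smoothTransition.zero_of_nonpos (le_of_lt hy)
    rw [this.deriv_eq, deriv_const]
  · have : Real.smoothTransition =ᶠ[𝓝 x] fun _ => 1 := by
      filter_upwards [lt_mem_nhds h] with y hy
      exact Real.smoothTransition.one_of_one_le (le_of_lt hy)
    rw [this.deriv_eq, deriv_const]

lemma continuous_deriv_cutoff (b k : ℝ) : Continuous (deriv (cutoff b k)) :=
  (contDiff_cutoff b k).continuous_deriv (by simp)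

/-- The total variation of the cut-offs is bounded uniformly in `k`. -/
lemma exists_integral_deriv_cutoff_le : ∃ C : ℝ, ∀ b k : ℝ, 0 < k →
    Integrable (deriv (cutoff b k)) ∧ ∫ t, |deriv (cutoff b k) t| ≤ C := by
  set S' := deriv Real.smoothTransition with hS'
  have hS'c : Continuous S' :=
    (Real.smoothTransition.contDiff (n := ⊤)).continuous_deriv (by simp)
  have hS'i : Integrable (fun x => |S' x|) :=
    (hS'c.integrable_of_hasCompactSupport hasCompactSupport_deriv_smoothTransition).abs
  refine ⟨2 * ∫ x, |S' x|, fun b k hk => ?_⟩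
  have hd : ∀ x, HasDerivAt Real.smoothTransition (S' x) x := fun x =>
    ((Real.smoothTransition.contDiff (n := ⊤)).differentiable (by simp) x).hasDerivAt
  have hderiv : ∀ t, |deriv (cutoff b k) t|
      ≤ k * |S' (k * t - 1)| + k * |S' (k * (b - t) - 1)| := by
    intro t
    have h1 : HasDerivAt (fun t => k * t - 1) k t := by
      simpa using ((hasDerivAt_id t).const_mul k).sub_const 1
    have h2 : HasDerivAt (fun t => k * (b - t) - 1) (-k) t := by
      simpa using (((hasDerivAt_id t).const_sub b).const_mul k).sub_const 1
    have h3 : HasDerivAt (cutoff b k) _ t := ((hd _).comp t h1).mul ((hd _).comp t h2)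
    rw [h3.deriv]
    have b1 : |Real.smoothTransition (k * t - 1)| ≤ 1 := by
      rw [abs_of_nonneg (Real.smoothTransition.nonneg _)]; exact Real.smoothTransition.le_one _
    have b2 : |Real.smoothTransition (k * (b - t) - 1)| ≤ 1 := by
      rw [abs_of_nonneg (Real.smoothTransition.nonneg _)]; exact Real.smoothTransition.le_one _
    refine (abs_add_le _ _).trans (add_le_add ?_ ?_)
    · simp only [abs_mul, abs_of_pos hk]
      nlinarith [mul_nonneg (abs_nonneg (S' (k * t - 1))) hk.le]
    · simp only [Function.comp, abs_mul, abs_neg, abs_of_pos hk]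
      nlinarith [mul_nonneg (abs_nonneg (S' (k * (b - t) - 1))) hk.le]
  have i1 : Integrable (fun t => k * |S' (k * t - 1)|) :=
    ((hS'i.comp_sub_right 1).comp_mul_left' hk.ne').const_mul k
  have i2 : Integrable (fun t => k * |S' (k * (b - t) - 1)|) :=
    (((hS'i.comp_sub_right 1).comp_mul_left' hk.ne').comp_sub_left b).const_mul k
  have v1 : ∫ t, k * |S' (k * t - 1)| = ∫ x, |S' x| := by
    rw [integral_const_mul, Measure.integral_comp_mul_left (fun x => |S' (x - 1)|) k,
      integral_sub_right_eq_self (fun x => |S' x|) 1, abs_of_pos (inv_pos.2 hk), smul_eq_mul,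
      mul_inv_cancel_left₀ hk.ne']
  have v2 : ∫ t, k * |S' (k * (b - t) - 1)| = ∫ x, |S' x| := by
    rw [← v1]
    exact integral_sub_left_eq_self (fun t => k * |S' (k * t - 1)|) volume b
  constructor
  · exact (i1.add i2).mono' (continuous_deriv_cutoff b k).aestronglyMeasurable
      (Eventually.of_forall hderiv)
  · calc ∫ t, |deriv (cutoff b k) t| ≤ ∫ t, (k * |S' (k * t - 1)| + k * |S' (k * (b - t) - 1)|) :=
        integral_mono_of_nonneg (Eventually.of_forall fun t => abs_nonneg _) (i1.add i2)
          (Eventually.of_forall hderiv)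
      _ = 2 * ∫ x, |S' x| := by rw [integral_add i1 i2, v1, v2]; ring

/-- The test function `χ(t) ψ(N (x - v t))`. -/
noncomputable def lineTest (χ ψ : ℝ → ℝ) (v N : ℝ) (p : ℝ × ℝ) : ℝ := χ p.1 * ψ (N * (p.2 - v * p.1))

section lineTest

variable {χ ψ : ℝ → ℝ} {v N : ℝ}

lemma dt_dx_lineTest (hχ : Differentiable ℝ χ) (hψ : Differentiable ℝ ψ) (p : ℝ × ℝ) :
    dt (lineTest χ ψ v N) p = deriv χ p.1 * ψ (N * (p.2 - v * p.1))
        - v * N * χ p.1 * deriv ψ (N * (p.2 - v * p.1)) ∧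
      dx (lineTest χ ψ v N) p = N * χ p.1 * deriv ψ (N * (p.2 - v * p.1)) := by
  have h1 : HasFDerivAt (fun p : ℝ × ℝ => χ p.1)
      (deriv χ p.1 • ContinuousLinearMap.fst ℝ ℝ ℝ) p :=
    (hχ p.1).hasDerivAt.comp_hasFDerivAt p (ContinuousLinearMap.fst ℝ ℝ ℝ).hasFDerivAt
  have h2 : HasFDerivAt (fun p : ℝ × ℝ => ψ (N * (p.2 - v * p.1)))
      (deriv ψ (N * (p.2 - v * p.1)) •
        (N • (ContinuousLinearMap.snd ℝ ℝ ℝ - v • ContinuousLinearMap.fst ℝ ℝ ℝ))) p :=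
    (hψ _).hasDerivAt.comp_hasFDerivAt p
      (N • (ContinuousLinearMap.snd ℝ ℝ ℝ - v • ContinuousLinearMap.fst ℝ ℝ ℝ)).hasFDerivAt
  have h3 : HasFDerivAt (lineTest χ ψ v N) _ p := h1.mul h2
  constructor
  · rw [dt, h3.fderiv]
    simp
    ring
  · rw [dx, h3.fderiv]
    simp
    ring

lemma isTest_lineTest {T : EReal} (hχ : ContDiff ℝ ∞ χ) (hψ : ContDiff ℝ ∞ ψ) {α β A : ℝ}
    (hsχ : Function.support χ ⊆ Icc α β) (hαβ : Icc α β ⊆ timeInterval T)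
    (hsψ : Function.support ψ ⊆ Icc (-A) A) (hN : 0 < N) : IsTest T (lineTest χ ψ v N) := by
  set K : Set (ℝ × ℝ) := (fun z : ℝ × ℝ => (z.1, z.2 / N + v * z.1)) '' (Icc α β ×ˢ Icc (-A) A)
    with hK
  have hKc : IsCompact K := (isCompact_Icc.prod isCompact_Icc).image (by fun_prop)
  have hsub : Function.support (lineTest χ ψ v N) ⊆ K := by
    intro p hp
    have h1 : χ p.1 ≠ 0 := left_ne_zero_of_mul hp
    have h2 : ψ (N * (p.2 - v * p.1)) ≠ 0 := right_ne_zero_of_mul hp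
    refine ⟨(p.1, N * (p.2 - v * p.1)), ⟨hsχ h1, hsψ h2⟩, ?_⟩
    ext
    · rfl
    · simp only
      field_simp
      ring
  refine ⟨?_, HasCompactSupport.of_support_subset_isCompact hKc hsub, ?_⟩
  · unfold lineTest
    exact (hχ.comp contDiff_fst).mul (hψ.comp (by fun_prop))
  · refine (closure_minimal hsub hKc.isClosed).trans ?_
    rintro _ ⟨z, hz, rfl⟩
    exact hαβ hz.1

end lineTest

/-! ### The dissipation measure -/

/-- Below the time level `N`, the time interval is an interval `(0,b)` with real `b`. -/
lemma exists_time_bound (T : EReal) (N : ℝ) :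
    ∃ b, Ioo 0 b ⊆ timeInterval T ∧ ∀ t ∈ timeInterval T, t < N → t < b := by
  induction T with
  | bot => exact ⟨0, by simp, fun t ht => absurd ht.2 (by simp)⟩
  | top => exact ⟨N, fun t ht => ⟨ht.1, EReal.coe_lt_top t⟩, fun t _ h => h⟩
  | coe T =>
    exact ⟨min T N, fun t ht => ⟨ht.1, EReal.coe_lt_coe_iff.2 (ht.2.trans_le (min_le_left _ _))⟩,
      fun t ht h => lt_min (EReal.coe_lt_coe_iff.1 ht.2) h⟩

/-- A cut-off in space: equal to one on `[-N,N]` and supported in `[-(N+1),N+1]`. -/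
noncomputable def spaceCutoff (N x : ℝ) : ℝ := cutoff (2 * (N + 2)) 1 (x + (N + 2))

lemma contDiff_spaceCutoff (N : ℝ) : ContDiff ℝ ∞ (spaceCutoff N) :=
  (contDiff_cutoff _ _).comp (by fun_prop)

lemma support_spaceCutoff_subset (N : ℝ) :
    Function.support (spaceCutoff N) ⊆ Icc (-(N + 1)) (N + 1) := by
  intro x hx
  have := support_cutoff_subset one_pos _ hx
  constructor
  · linarith [this.1]
  · linarith [this.2]

lemma hasCompactSupport_of_support_subset_Icc {ψ : ℝ → ℝ} {A B : ℝ}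
    (h : Function.support ψ ⊆ Icc A B) : HasCompactSupport ψ :=
  HasCompactSupport.of_support_subset_isCompact isCompact_Icc h

lemma integrable_of_support_subset_Icc {ψ : ℝ → ℝ} (hψ : ContDiff ℝ ∞ ψ) {A B : ℝ}
    (h : Function.support ψ ⊆ Icc A B) : Integrable ψ ∧ Integrable (deriv ψ) :=
  ⟨hψ.continuous.integrable_of_hasCompactSupport (hasCompactSupport_of_support_subset_Icc h),
    (hψ.continuous_deriv (by simp)).integrable_of_hasCompactSupport
      (hasCompactSupport_of_support_subset_Icc h).deriv⟩

lemma integrable_cutoff (b : ℝ) {k : ℝ} (hk : 0 < k) : Integrable (cutoff b k) :=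
  (integrable_of_support_subset_Icc (contDiff_cutoff b k) (support_cutoff_subset hk b)).1

/-- The pairing of a nonnegative divergence with the cut-offs of a rectangle is bounded, uniformly
as the cut-offs fill up the rectangle. -/
lemma exists_pairing_cutoff_le {T : EReal} {a c : ℝ × ℝ → ℝ} {M : ℝ}
    (haM : ∀ p, |a p| ≤ M) (hcM : ∀ p, |c p| ≤ M) (b N : ℝ) :
    ∃ C : ℝ, ∀ k : ℝ, 0 < k →
      ∫ p in strip T, (dt (lineTest (cutoff b k) (spaceCutoff N) 0 1) p * a p
        + dx (lineTest (cutoff b k) (spaceCutoff N) 0 1) p * c p) ≤ C := by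
  obtain ⟨C₀, hC₀⟩ := exists_integral_deriv_cutoff_le
  set ψ := spaceCutoff N with hψdef
  have hψ := contDiff_spaceCutoff N
  have hM : 0 ≤ M := (abs_nonneg _).trans (haM 0)
  obtain ⟨iψ, iψ'⟩ := integrable_of_support_subset_Icc hψ (support_spaceCutoff_subset N)
  refine ⟨M * (C₀ * ∫ x, |ψ x|) + M * (volume.real (Ioo 0 b) * ∫ x, |deriv ψ x|),
    fun k hk => ?_⟩
  obtain ⟨iχ', hχ'⟩ := hC₀ b k hk
  have iχ := integrable_cutoff b hk
  have i1 : Integrable (fun p : ℝ × ℝ => M * (|deriv (cutoff b k) p.1| * |ψ p.2|)) :=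
    (iχ'.abs.mul_prod iψ.abs).const_mul M
  have i2 : Integrable (fun p : ℝ × ℝ => M * (|cutoff b k p.1| * |deriv ψ p.2|)) :=
    (iχ.abs.mul_prod iψ'.abs).const_mul M
  have hχ : ∫ t, |cutoff b k t| ≤ volume.real (Ioo 0 b) := by
    rw [← integral_indicator_one measurableSet_Ioo]
    refine integral_mono iχ.abs ((integrable_indicator_iff measurableSet_Ioo).2
      (integrableOn_const (by simp))) fun t => ?_
    by_cases ht : t ∈ Ioo 0 b
    · rw [indicator_of_mem ht, abs_of_nonneg (cutoff_nonneg _ _ _)]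
      exact cutoff_le_one _ _ _
    · have : cutoff b k t = 0 := by
        by_contra h
        exact ht (Icc_subset_Ioo_of_pos hk b (support_cutoff_subset hk b h))
      simp [this, indicator_of_notMem ht]
  refine (le_abs_self _).trans ?_
  rw [← Real.norm_eq_abs]
  refine (norm_integral_le_of_norm_le (i1.add i2).integrableOn (Eventually.of_forall fun p => ?_)).trans
    ((setIntegral_le_integral (i1.add i2) (Eventually.of_forall fun p => ?_)).trans ?_)
  · obtain ⟨h1, h2⟩ := dt_dx_lineTest (v := 0) (N := 1)
      ((contDiff_cutoff b k).differentiable (by simp)) (hψ.differentiable (by simp)) p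
    rw [h1, h2, Real.norm_eq_abs]
    simp only [zero_mul, sub_zero, one_mul]
    refine (abs_add_le _ _).trans (add_le_add ?_ ?_)
    · rw [abs_mul, abs_mul, mul_comm]
      exact mul_le_mul_of_nonneg_right (haM p) (by positivity)
    · rw [abs_mul, abs_mul, mul_comm]
      exact mul_le_mul_of_nonneg_right (hcM p) (by positivity)
  · simp only [Pi.add_apply, Pi.zero_apply]
    positivity
  · have e := integral_add i1 i2
    simp only [Pi.add_def]
    rw [e, integral_const_mul, integral_const_mul, Measure.volume_eq_prod,
      integral_prod_mul (fun t => |deriv (cutoff b k) t|) (fun x => |ψ x|),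
      integral_prod_mul (fun t => |cutoff b k t|) (fun x => |deriv ψ x|)]
    gcongr

/-- A distribution `-(∂ₜ a + ∂ₓ c) ≥ 0` with bounded `a`, `c` is a measure which is finite up to the
boundary of the strip. -/
theorem exists_dissipation_measure {T : EReal} {a c : ℝ × ℝ → ℝ} {M : ℝ} (ha : Measurable a)
    (hc : Measurable c) (haM : ∀ p, |a p| ≤ M) (hcM : ∀ p, |c p| ≤ M)
    (hpos : ∀ φ, IsTest T φ → (∀ p, 0 ≤ φ p) →
      0 ≤ ∫ p in strip T, (dt φ p * a p + dx φ p * c p)) :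
    ∃ m : Measure (ℝ × ℝ), IsLocallyFiniteMeasure m ∧ m (strip T)ᶜ = 0 ∧
      ∀ φ, IsTest T φ → ∫ p, φ p ∂m = ∫ p in strip T, (dt φ p * a p + dx φ p * c p) := by
  obtain ⟨m, hm0, hm⟩ := exists_measure_of_nonneg_functional
    (fun φ => ∫ p in strip T, (dt φ p * a p + dx φ p * c p))
    (fun φ ψ hφ hψ => by
      rw [← integral_add (hφ.integrable_pairing ha hc haM hcM).integrableOn
        (hψ.integrable_pairing ha hc haM hcM).integrableOn]
      refine integral_congr_ae (Eventually.of_forall fun p => ?_)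
      simp only [hφ.dt_add hψ, hφ.dx_add hψ]
      ring)
    (fun r φ hφ => by
      rw [← integral_const_mul]
      refine integral_congr_ae (Eventually.of_forall fun p => ?_)
      simp only [hφ.dt_smul, hφ.dx_smul]
      ring) hpos
  refine ⟨m, ⟨fun p => ?_⟩, hm0, fun φ hφ => (hm φ hφ).2⟩
  obtain ⟨N, hN⟩ := exists_gt ‖p‖
  have hN0 : 0 < N := (norm_nonneg p).trans_lt hN
  obtain ⟨b, hb, hb'⟩ := exists_time_bound T N
  obtain ⟨C, hC⟩ := exists_pairing_cutoff_le (T := T) haM hcM b N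
  -- an exhaustion of the part of the ball inside the strip
  set S : ℕ → Set (ℝ × ℝ) := fun k =>
    {z | 2 ≤ (k + 1 : ℝ) * z.1 ∧ 2 ≤ (k + 1 : ℝ) * (b - z.1) ∧ |z.2| ≤ N} with hS
  have hSm : Monotone S := by
    intro k l hkl z hz
    have hk1 : (0 : ℝ) < k + 1 := by positivity
    have hkl' : (k : ℝ) + 1 ≤ l + 1 := by exact_mod_cast Nat.succ_le_succ hkl
    have h1 : 0 < z.1 := pos_of_mul_pos_right (lt_of_lt_of_le two_pos hz.1) hk1.le
    have h2 : 0 < b - z.1 := pos_of_mul_pos_right (lt_of_lt_of_le two_pos hz.2.1) hk1.le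
    exact ⟨hz.1.trans (mul_le_mul_of_nonneg_right hkl' h1.le),
      hz.2.1.trans (mul_le_mul_of_nonneg_right hkl' h2.le), hz.2.2⟩
  have hSC : ∀ k, m (S k) ≤ ENNReal.ofReal C := by
    intro k
    have hk1 : (0 : ℝ) < k + 1 := by positivity
    have htest : IsTest T (lineTest (cutoff b (k + 1)) (spaceCutoff N) 0 1) :=
      isTest_lineTest (contDiff_cutoff _ _) (contDiff_spaceCutoff N)
        (support_cutoff_subset hk1 b) ((Icc_subset_Ioo_of_pos hk1 b).trans hb)
        (support_spaceCutoff_subset N) one_pos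
    obtain ⟨hint, heq⟩ := hm _ htest
    have hle := mul_meas_ge_le_lintegral₀ (μ := m)
      (f := fun z => ENNReal.ofReal (lineTest (cutoff b (k + 1)) (spaceCutoff N) 0 1 z))
      hint.aestronglyMeasurable.aemeasurable.ennreal_ofReal 1
    rw [one_mul, ← ofReal_integral_eq_lintegral_ofReal hint (Eventually.of_forall fun z =>
      mul_nonneg (cutoff_nonneg _ _ _) (cutoff_nonneg _ _ _)), heq] at hle
    refine (measure_mono fun z hz => ?_).trans (hle.trans (ENNReal.ofReal_le_ofReal (hC _ hk1)))
    have h3 := abs_le.1 hz.2.2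
    have : lineTest (cutoff b (k + 1)) (spaceCutoff N) 0 1 z = 1 := by
      unfold lineTest spaceCutoff
      rw [cutoff_eq_one hz.1 hz.2.1, cutoff_eq_one (by linarith [h3.1]) (by linarith [h3.2]),
        one_mul]
    simp [this]
  refine ⟨Metric.ball 0 N, Metric.isOpen_ball.mem_nhds (by simpa using hN), ?_⟩
  have hsub : Metric.ball 0 N ⊆ (⋃ k, S k) ∪ (strip T)ᶜ := by
    intro z hz
    by_cases hzT : z ∈ strip T
    · left
      have hz' : ‖z‖ < N := by simpa using hz
      have h1 : |z.1| < N := (norm_fst_le z).trans_lt hz'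
      have h2 : |z.2| < N := (norm_snd_le z).trans_lt hz'
      have h3 : 0 < z.1 := hzT.1
      have h4 : z.1 < b := hb' z.1 hzT ((le_abs_self _).trans_lt h1)
      obtain ⟨k, hk⟩ := exists_nat_ge (max (2 / z.1) (2 / (b - z.1)))
      have h5 : 2 ≤ (k : ℝ) * z.1 := (div_le_iff₀ h3).1 ((le_max_left _ _).trans hk)
      have h6 : 2 ≤ (k : ℝ) * (b - z.1) :=
        (div_le_iff₀ (sub_pos.2 h4)).1 ((le_max_right _ _).trans hk)
      exact mem_iUnion.2 ⟨k, by linarith, by linarith, h2.le⟩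
    · exact Or.inr hzT
  calc m (Metric.ball 0 N) ≤ m (⋃ k, S k) + m (strip T)ᶜ :=
        (measure_mono hsub).trans (measure_union_le _ _)
    _ ≤ ENNReal.ofReal C := by
        rw [hm0, add_zero, hSm.measure_iUnion]
        exact iSup_le hSC
    _ < ⊤ := ENNReal.ofReal_lt_top

/-! ### Traces along a line -/

/-- A bump with `bump 0 = 1`, supported in `[-1,1]`. -/
noncomputable def bump (y : ℝ) : ℝ := cutoff 2 2 (y + 1)

lemma contDiff_bump : ContDiff ℝ ∞ bump := (contDiff_cutoff _ _).comp (by fun_prop)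

lemma bump_zero : bump 0 = 1 := cutoff_eq_one (by norm_num) (by norm_num)

lemma support_bump_subset : Function.support bump ⊆ Ioo (-1) 1 := by
  intro x hx
  have := support_cutoff_subset two_pos _ hx
  constructor
  · linarith [this.1]
  · linarith [this.2]

lemma integral_deriv_bump_right : ∫ y in Ioo (0 : ℝ) 1, deriv bump y = -1 := by
  have h1 : bump 1 = 0 := by
    by_contra h
    exact absurd (support_bump_subset h).2 (lt_irrefl _)
  rw [← integral_Ioc_eq_integral_Ioo, ← intervalIntegral.integral_of_le zero_le_one,
    intervalIntegral.integral_deriv_eq_sub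
      (fun x _ => contDiff_bump.differentiable (by simp) x)
      ((contDiff_bump.continuous_deriv (by simp)).intervalIntegrable _ _), h1, bump_zero]
  norm_num

lemma integral_deriv_bump_left : ∫ y in Ioo (-1 : ℝ) 0, deriv bump y = 1 := by
  have h1 : bump (-1) = 0 := by
    by_contra h
    exact absurd (support_bump_subset h).1 (lt_irrefl _)
  rw [← integral_Ioc_eq_integral_Ioo, ← intervalIntegral.integral_of_le (by norm_num),
    intervalIntegral.integral_deriv_eq_sub
      (fun x _ => contDiff_bump.differentiable (by simp) x)
      ((contDiff_bump.continuous_deriv (by simp)).intervalIntegrable _ _), h1, bump_zero]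
  norm_num

lemma integrable_bump : Integrable bump ∧ Integrable (deriv bump) :=
  integrable_of_support_subset_Icc contDiff_bump (support_bump_subset.trans Ioo_subset_Icc_self)

lemma exists_norm_deriv_bump_le : ∃ C : NNReal, ∀ y, ‖deriv bump y‖ₑ ≤ C := by
  obtain ⟨C, hC⟩ := (hasCompactSupport_of_support_subset_Icc (support_bump_subset.trans
    Ioo_subset_Icc_self)).deriv.exists_bound_of_continuous
    (contDiff_bump.continuous_deriv (by simp))
  refine ⟨C.toNNReal, fun y => ?_⟩
  rw [enorm_eq_nnnorm, ENNReal.coe_le_coe]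
  exact NNReal.le_toNNReal_of_coe_le (hC y)

lemma integral_deriv_bump_mul {g : ℝ → ℝ} (hg : Integrable (fun y => deriv bump y * g y)) :
    ∫ y, deriv bump y * g y
      = (∫ y in Ioo (-1 : ℝ) 0, deriv bump y * g y) + ∫ y in Ioo (0 : ℝ) 1, deriv bump y * g y := by
  have h1 : ∫ y, deriv bump y * g y = ∫ y in Ioc (-1 : ℝ) 1, deriv bump y * g y := by
    rw [setIntegral_eq_integral_of_forall_compl_eq_zero]
    intro y hy
    have : deriv bump y = 0 := by
      by_contra h
      have h2 : y ∈ tsupport bump := support_deriv_subset h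
      have h3 : tsupport bump ⊆ Icc (1 / 2 - 1) (2 - 1 / 2 - 1) := by
        refine closure_minimal (fun x hx => ?_) isClosed_Icc
        have := support_cutoff_subset two_pos _ hx
        exact ⟨by linarith [this.1], by linarith [this.2]⟩
      have h4 := h3 h2
      exact hy ⟨by linarith [h4.1], by linarith [h4.2]⟩
    rw [this, zero_mul]
  rw [h1, ← Ioc_union_Ioc_eq_Ioc (b := (0 : ℝ)) (by norm_num) (by norm_num),
    setIntegral_union (by simp) measurableSet_Ioc hg.integrableOn hg.integrableOn,
    integral_Ioc_eq_integral_Ioo, integral_Ioc_eq_integral_Ioo]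

/-- For a nonnegative divergence `-(∂ₜ a + ∂ₓ c)`, the flux `c - v a` through the line `x = v t`
does not increase across the line: this is seen by testing with functions that concentrate on the
line. -/
theorem flux_trace_le {T : EReal} {a c : ℝ × ℝ → ℝ} {M b v : ℝ} (ha : Measurable a)
    (hc : Measurable c) (haM : ∀ p, |a p| ≤ M) (hcM : ∀ p, |c p| ≤ M)
    (hpos : ∀ φ, IsTest T φ → (∀ p, 0 ≤ φ p) →
      0 ≤ ∫ p in strip T, (dt φ p * a p + dx φ p * c p))
    (hb : Ioo 0 b ⊆ timeInterval T) {jp jm : ℝ → ℝ}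
    (hjp : IntegrableOn jp (Ioo 0 b)) (hjm : IntegrableOn jm (Ioo 0 b))
    (hp : Tendsto (fun n : ℕ => ∫⁻ t in Ioo 0 b, ∫⁻ y in Ioo (0 : ℝ) 1,
      ‖c (t, v * t + y / (n + 1)) - v * a (t, v * t + y / (n + 1)) - jp t‖ₑ) atTop (𝓝 0))
    (hm : Tendsto (fun n : ℕ => ∫⁻ t in Ioo 0 b, ∫⁻ y in Ioo (-1 : ℝ) 0,
      ‖c (t, v * t + y / (n + 1)) - v * a (t, v * t + y / (n + 1)) - jm t‖ₑ) atTop (𝓝 0)) :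
    ∫ t in Ioo 0 b, jp t ≤ ∫ t in Ioo 0 b, jm t := by
  have hM : 0 ≤ M := (abs_nonneg _).trans (haM 0)
  set j : ℝ × ℝ → ℝ := fun p => c p - v * a p with hj
  have hjmeas : Measurable j := hc.sub (ha.const_mul v)
  have hjM : ∀ p, |j p| ≤ M + |v| * M := fun p => by
    refine (abs_sub _ _).trans (add_le_add (hcM p) ?_)
    rw [abs_mul]
    exact mul_le_mul_of_nonneg_left (haM p) (abs_nonneg v)
  obtain ⟨iψ, iψ'⟩ := integrable_bump
  have hψ'c : Continuous (deriv bump) := contDiff_bump.continuous_deriv (by simp)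
  have hcoord : ∀ N : ℝ, Measurable (fun p : ℝ × ℝ => (p.1, v * p.1 + p.2 / N)) := fun N => by
    fun_prop
  have hcoord' : ∀ N t : ℝ, Measurable (fun y : ℝ => (t, v * t + y / N)) := fun N t => by
    fun_prop
  set I : ℝ → ℝ → ℝ := fun N t => ∫ y, deriv bump y * j (t, v * t + y / N) with hI
  set H : ℝ → ℝ → ℝ := fun N t => ∫ y, bump y * a (t, v * t + y / N) with hH
  have hIi : ∀ N t, Integrable (fun y => deriv bump y * j (t, v * t + y / N)) := fun N t =>
    iψ'.mul_bdd (c := M + |v| * M) (hjmeas.comp (hcoord' N t)).aestronglyMeasurable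
      (Eventually.of_forall fun _ => hjM _)
  have hHi : ∀ N t, Integrable (fun y => bump y * a (t, v * t + y / N)) := fun N t =>
    iψ.mul_bdd (c := M) (ha.comp (hcoord' N t)).aestronglyMeasurable
      (Eventually.of_forall fun _ => haM _)
  have hIm : ∀ N, StronglyMeasurable (I N) := fun N =>
    StronglyMeasurable.integral_prod_right (f := fun t y => deriv bump y * j (t, v * t + y / N))
      ((hψ'c.measurable.comp measurable_snd).mul (hjmeas.comp (hcoord N))).stronglyMeasurable
  have hHm : ∀ N, StronglyMeasurable (H N) := fun N =>
    StronglyMeasurable.integral_prod_right (f := fun t y => bump y * a (t, v * t + y / N))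
      ((contDiff_bump.continuous.measurable.comp measurable_snd).mul
        (ha.comp (hcoord N))).stronglyMeasurable
  have hIb : ∀ N t, ‖I N t‖ ≤ ∫ y, |deriv bump y| * (M + |v| * M) := fun N t => by
    refine norm_integral_le_of_norm_le (iψ'.abs.mul_const _) (Eventually.of_forall fun y => ?_)
    rw [Real.norm_eq_abs, abs_mul]
    exact mul_le_mul_of_nonneg_left (hjM _) (abs_nonneg _)
  have hHb : ∀ N t, ‖H N t‖ ≤ ∫ y, |bump y| * M := fun N t => by
    refine norm_integral_le_of_norm_le (iψ.abs.mul_const _) (Eventually.of_forall fun y => ?_)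
    rw [Real.norm_eq_abs, abs_mul]
    exact mul_le_mul_of_nonneg_left (haM _) (abs_nonneg _)
  -- the entropy inequality for the test function `χ(t) ψ(N (x - v t))`, in the variables
  -- `t` and `y = N (x - v t)`
  have hent : ∀ k N : ℝ, 0 < k → 0 < N →
      0 ≤ (∫ t in Ioo 0 b, cutoff b k t * I N t) + N⁻¹ * ∫ t, deriv (cutoff b k) t * H N t := by
    intro k N hk hN
    have htest : IsTest T (lineTest (cutoff b k) bump v N) :=
      isTest_lineTest (contDiff_cutoff _ _) contDiff_bump
        (support_cutoff_subset hk b) ((Icc_subset_Ioo_of_pos hk b).trans hb)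
        (by simpa using support_bump_subset.trans Ioo_subset_Icc_self) hN
    have h0 := hpos _ htest fun p => mul_nonneg (cutoff_nonneg _ _ _) (cutoff_nonneg _ _ _)
    rw [setIntegral_eq_integral_of_forall_compl_eq_zero (by
      intro p hp
      have hz : fderiv ℝ (lineTest (cutoff b k) bump v N) p = 0 := by
        by_contra h
        exact hp (htest.support_subset (support_fderiv_subset ℝ h))
      simp [dt, dx, hz]), Measure.volume_eq_prod,
      integral_prod _ (htest.integrable_pairing ha hc haM hcM)] at h0
    have hinner : ∀ t, ∫ x, (dt (lineTest (cutoff b k) bump v N) (t, x) * a (t, x)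
          + dx (lineTest (cutoff b k) bump v N) (t, x) * c (t, x))
        = cutoff b k t * I N t + N⁻¹ * (deriv (cutoff b k) t * H N t) := by
      intro t
      set F : ℝ → ℝ := fun y => N * (cutoff b k t * (deriv bump y * j (t, v * t + y / N)))
        + deriv (cutoff b k) t * (bump y * a (t, v * t + y / N)) with hF
      have e1 : ∀ x, dt (lineTest (cutoff b k) bump v N) (t, x) * a (t, x)
          + dx (lineTest (cutoff b k) bump v N) (t, x) * c (t, x) = F (N * (x - v * t)) := by
        intro x
        obtain ⟨h1, h2⟩ := dt_dx_lineTest (v := v) (N := N)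
          ((contDiff_cutoff b k).differentiable (by simp))
          (contDiff_bump.differentiable (by simp)) (t, x)
        have h3 : v * t + N * (x - v * t) / N = x := by field_simp; ring
        rw [h1, h2, hF]
        simp only [h3, hj]
        ring
      simp_rw [e1]
      rw [integral_sub_right_eq_self (fun x => F (N * x)) (v * t), Measure.integral_comp_mul_left,
        hF, integral_add (((hIi N t).const_mul _).const_mul _) ((hHi N t).const_mul _),
        integral_const_mul, integral_const_mul, integral_const_mul, abs_of_pos (inv_pos.2 hN),
        smul_eq_mul]
      simp only [hI, hH]
      field_simp
    simp_rw [hinner] at h0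
    obtain ⟨C₀, hC₀⟩ := exists_integral_deriv_cutoff_le
    have k1 : Integrable (fun t => cutoff b k t * I N t) :=
      (integrable_cutoff b hk).mul_bdd (hIm N).aestronglyMeasurable (Eventually.of_forall (hIb N))
    have k2 : Integrable (fun t => deriv (cutoff b k) t * H N t) :=
      (hC₀ b k hk).1.mul_bdd (hHm N).aestronglyMeasurable (Eventually.of_forall (hHb N))
    rw [integral_add k1 (k2.const_mul _), integral_const_mul] at h0
    rwa [setIntegral_eq_integral_of_forall_compl_eq_zero]
    intro t ht
    have : cutoff b k t = 0 := by
      by_contra h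
      exact ht (Icc_subset_Ioo_of_pos hk b (support_cutoff_subset hk b h))
    rw [this, zero_mul]
  -- the limit in which the test functions concentrate on the line
  have hlim : ∀ k : ℝ, 0 < k → 0 ≤ ∫ t in Ioo 0 b, cutoff b k t * (jm t - jp t) := by
    intro k hk
    obtain ⟨C₁, hC₁⟩ := exists_norm_deriv_bump_le
    have hχi := integrable_cutoff b hk
    have t1 : Tendsto (fun n : ℕ => ∫ t in Ioo 0 b, cutoff b k t * I (n + 1) t) atTop
        (𝓝 (∫ t in Ioo 0 b, cutoff b k t * (jm t - jp t))) := by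
      refine tendsto_integral_of_L1 _ ?_ (Eventually.of_forall fun n => ?_) ?_
      · exact (contDiff_cutoff b k).continuous.aestronglyMeasurable.mul
          (hjm.aestronglyMeasurable.sub hjp.aestronglyMeasurable)
      · exact (hχi.mul_bdd (hIm _).aestronglyMeasurable
          (Eventually.of_forall (hIb _))).integrableOn
      · have hz : Tendsto (fun n : ℕ => (C₁ : ℝ≥0∞) *
            ((∫⁻ t in Ioo 0 b, ∫⁻ y in Ioo (-1 : ℝ) 0,
              ‖j (t, v * t + y / (n + 1)) - jm t‖ₑ)
            + ∫⁻ t in Ioo 0 b, ∫⁻ y in Ioo (0 : ℝ) 1,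
              ‖j (t, v * t + y / (n + 1)) - jp t‖ₑ)) atTop (𝓝 0) := by
          have := ENNReal.Tendsto.const_mul (a := (C₁ : ℝ≥0∞)) (hm.add hp)
            (Or.inr ENNReal.coe_ne_top)
          simpa using this
        refine tendsto_of_tendsto_of_tendsto_of_le_of_le tendsto_const_nhds hz
          (fun _ => zero_le) fun n => ?_
        have hpt : ∀ t, ‖cutoff b k t * I (n + 1) t - cutoff b k t * (jm t - jp t)‖ₑ
            ≤ C₁ * ((∫⁻ y in Ioo (-1 : ℝ) 0, ‖j (t, v * t + y / (n + 1)) - jm t‖ₑ)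
              + ∫⁻ y in Ioo (0 : ℝ) 1, ‖j (t, v * t + y / (n + 1)) - jp t‖ₑ) := by
          intro t
          have hside : ∀ (s : Set ℝ) (w e : ℝ), (∫ y in s, deriv bump y) = e →
              ‖(∫ y in s, deriv bump y * j (t, v * t + y / (n + 1))) - e * w‖ₑ
                ≤ C₁ * ∫⁻ y in s, ‖j (t, v * t + y / (n + 1)) - w‖ₑ := by
            intro s w e he
            rw [← he, ← integral_mul_const, ← integral_sub (hIi _ _).integrableOn
              (iψ'.mul_const w).integrableOn, ← lintegral_const_mul' _ _ ENNReal.coe_ne_top]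
            refine (enorm_integral_le_lintegral_enorm _).trans (lintegral_mono fun y => ?_)
            rw [← mul_sub, enorm_mul]
            exact mul_le_mul_left (hC₁ y) _
          have e1 : I (n + 1) t - (jm t - jp t)
              = ((∫ y in Ioo (-1 : ℝ) 0, deriv bump y * j (t, v * t + y / (n + 1))) - 1 * jm t)
              + ((∫ y in Ioo (0 : ℝ) 1, deriv bump y * j (t, v * t + y / (n + 1)))
                - (-1) * jp t) := by
            simp only [hI]
            rw [integral_deriv_bump_mul (hIi _ _)]
            ring
          rw [← mul_sub, enorm_mul, e1, mul_add]
          have hχ1 : ‖cutoff b k t‖ₑ ≤ 1 := by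
            rw [Real.enorm_eq_ofReal (cutoff_nonneg _ _ _)]
            exact ENNReal.ofReal_le_one.2 (cutoff_le_one _ _ _)
          calc _ ≤ 1 * ‖((∫ y in Ioo (-1 : ℝ) 0, deriv bump y * j (t, v * t + y / (n + 1)))
                - 1 * jm t) + ((∫ y in Ioo (0 : ℝ) 1, deriv bump y * j (t, v * t + y / (n + 1)))
                - (-1) * jp t)‖ₑ := mul_le_mul_left hχ1 _
            _ ≤ _ := by
              rw [one_mul]
              exact (enorm_add_le _ _).trans (add_le_add
                (hside _ _ _ integral_deriv_bump_left) (hside _ _ _ integral_deriv_bump_right))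
        refine (lintegral_mono hpt).trans (le_of_eq ?_)
        rw [lintegral_const_mul' _ _ ENNReal.coe_ne_top, lintegral_add_left']
        refine AEMeasurable.lintegral_prod_right' (f := fun p : ℝ × ℝ =>
          ‖j (p.1, v * p.1 + p.2 / (n + 1)) - jm p.1‖ₑ) ?_
        refine AEMeasurable.enorm ?_
        refine (hjmeas.comp (hcoord _)).aemeasurable.sub ?_
        exact hjm.aestronglyMeasurable.aemeasurable.comp_fst
    have t2 : Tendsto (fun n : ℕ => ((n : ℝ) + 1)⁻¹ * ∫ t, deriv (cutoff b k) t * H (n + 1) t)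
        atTop (𝓝 0) := by
      obtain ⟨C₀, hC₀⟩ := exists_integral_deriv_cutoff_le
      have hi := (hC₀ b k hk).1
      have hlim0 : Tendsto (fun n : ℕ => ((n : ℝ) + 1)⁻¹) atTop (𝓝 0) := by
        simpa [one_div] using tendsto_one_div_add_atTop_nhds_zero_nat (𝕜 := ℝ)
      refine hlim0.zero_mul_isBoundedUnder_le ?_
      refine isBoundedUnder_of ⟨∫ t, |deriv (cutoff b k) t| * ∫ y, |bump y| * M, fun n => ?_⟩
      refine norm_integral_le_of_norm_le (hi.abs.mul_const _) (Eventually.of_forall fun t => ?_)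
      rw [norm_mul, Real.norm_eq_abs]
      exact mul_le_mul_of_nonneg_left (hHb _ _) (abs_nonneg _)
    have t3 := t1.add t2
    rw [add_zero] at t3
    exact ge_of_tendsto' t3 fun n => hent k (n + 1) hk (by positivity)
  -- the limit in which the cut-off in time exhausts `(0,b)`
  have hdiff : IntegrableOn (fun t => jm t - jp t) (Ioo 0 b) := hjm.sub hjp
  have t4 : Tendsto (fun k : ℕ => ∫ t in Ioo 0 b, cutoff b k t * (jm t - jp t)) atTop
      (𝓝 (∫ t in Ioo 0 b, (jm t - jp t))) := by
    refine tendsto_integral_of_dominated_convergence (fun t => |jm t - jp t|) (fun k => ?_)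
      hdiff.abs (fun k => Eventually.of_forall fun t => ?_) ?_
    · exact (contDiff_cutoff b k).continuous.aestronglyMeasurable.mul hdiff.aestronglyMeasurable
    · rw [norm_mul, Real.norm_eq_abs, Real.norm_eq_abs, abs_of_nonneg (cutoff_nonneg _ _ _)]
      exact mul_le_of_le_one_left (abs_nonneg _) (cutoff_le_one _ _ _)
    · filter_upwards [ae_restrict_mem measurableSet_Ioo] with t ht
      simpa using (tendsto_cutoff ht).mul_const (jm t - jp t)
  have h5 : 0 ≤ ∫ t in Ioo 0 b, (jm t - jp t) := by
    refine ge_of_tendsto t4 ?_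
    filter_upwards [eventually_gt_atTop 0] with k hk
    exact hlim k (by exact_mod_cast hk)
  rw [integral_sub hjm hjp] at h5
  linarith

/-! ### Entropy solutions with values in a small ball -/

lemma measurable_comp_of_continuousOn {X E : Type*} [MeasurableSpace X] [TopologicalSpace E]
    [MeasurableSpace E] [BorelSpace E] {B : Set State} {F : State → E} (hF : ContinuousOn F B)
    {w : X → State} (hw : Measurable w) (hwB : ∀ x, w x ∈ B) : Measurable fun x => F (w x) :=
  (continuousOn_iff_continuous_domRestrict.1 hF).measurable.comp
    (hw.subtype_mk (h := hwB))

lemma integrableOn_comp_of_continuousOn {B : Set State} (hB : IsCompact B) (hBne : B.Nonempty)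
    {F : State → ℝ} (hF : ContinuousOn F B) {w : ℝ → State} {s : Set ℝ} (hs : volume s ≠ ⊤)
    (hw : AEStronglyMeasurable w (volume.restrict s)) (hwB : ∀ᵐ t ∂(volume.restrict s), w t ∈ B) :
    IntegrableOn (fun t => F (w t)) s := by
  obtain ⟨g, hg, hgB, hwg⟩ := hw.aemeasurable.exists_ae_eq_range_subset hwB hBne
  have hgB' : ∀ t, g t ∈ B := fun t => hgB (mem_range_self t)
  obtain ⟨M, hM⟩ := hB.exists_bound_of_continuousOn hF
  have hi : IntegrableOn (fun t => F (g t)) s :=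
    Measure.integrableOn_of_bounded (M := M) hs
      (measurable_comp_of_continuousOn hF hg hgB').aestronglyMeasurable
      (Eventually.of_forall fun t => hM _ (hgB' t))
  refine hi.congr ?_
  filter_upwards [hwg] with t ht
  rw [ht]

lemma exists_lipschitzOnWith_of_contDiffAt {B : Set State} (hB : IsCompact B) {F : State → ℝ}
    (hF : ∀ x ∈ B, ContDiffAt ℝ 1 F x) : ∃ L, LipschitzOnWith L F B := by
  refine LocallyLipschitzOn.exists_lipschitzOnWith_of_compact hB fun x hx => ?_
  obtain ⟨K, t, ht, hK⟩ := (hF x hx).exists_lipschitzOnWith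
  exact ⟨K, t, mem_nhdsWithin_of_mem_nhds ht, hK⟩

lemma integral_dt_dx_eq_zero {T : EReal} {φ : ℝ × ℝ → ℝ} (hφ : IsTest T φ) :
    ∫ p in strip T, dt φ p = 0 ∧ ∫ p in strip T, dx φ p = 0 := by
  have key : ∀ z : ℝ × ℝ, Integrable (fun p => fderiv ℝ φ p z) →
      ∫ p in strip T, fderiv ℝ φ p z = 0 := by
    intro z hz
    rw [setIntegral_eq_integral_of_forall_compl_eq_zero]
    · have := integral_mul_fderiv_eq_neg_fderiv_mul_of_integrable (𝕜 := ℝ) (μ := volume)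
        (f := fun _ : ℝ × ℝ => (1 : ℝ)) (g := φ) (v := z) (by simp) (by simpa using hz)
        (by simpa using hφ.smooth.continuous.integrable_of_hasCompactSupport hφ.compact)
        (by simp) (fun x _ => hφ.differentiable x)
      simpa using this
    · intro p hp
      have hz : fderiv ℝ φ p = 0 := by
        by_contra h
        exact hp (hφ.support_subset (support_fderiv_subset ℝ h))
      simp [hz]
  exact ⟨key (1, 0) hφ.integrable_dt, key (0, 1) hφ.integrable_dx⟩

/-- The strong trace in averaged form: after rescaling the distance to the line, the solution
converges to its trace in `L¹`. The essential supremum in the definition may fail to be measurable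
in `t`; only its lower integral is used. -/
lemma tendsto_scaled_trace {T : EReal} {u u' : ℝ × ℝ → State}
    (hu : u =ᵐ[volume.restrict (strip T)] u') {v b : ℝ} (hb : Ioo 0 b ⊆ timeInterval T)
    {w : ℝ → State} {I : Set ℝ} {J : ℕ → Set ℝ} (hI : MeasurableSet I) (hI1 : volume I ≤ 1)
    (hJ : ∀ n, MeasurableSet (J n)) (hIJ : ∀ n : ℕ, ∀ y ∈ I, y / (n + 1) ∈ J n)
    (h : Tendsto (fun n : ℕ => ∫⁻ t in Ioo 0 b,
      essSup (fun y : ℝ => ‖u (t, v * t + y) - w t‖ₑ) (volume.restrict (J n))) atTop (𝓝 0)) :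
    Tendsto (fun n : ℕ => ∫⁻ t in Ioo 0 b, ∫⁻ y in I, ‖u' (t, v * t + y / (n + 1)) - w t‖ₑ)
      atTop (𝓝 0) := by
  refine tendsto_of_tendsto_of_tendsto_of_le_of_le tendsto_const_nhds h
    (fun _ => zero_le) fun n => ?_
  rw [Filter.EventuallyEq, volume_restrict_strip] at hu
  have h1 := ae_mono (Measure.restrict_mono_set volume hb) (Measure.ae_ae_of_ae_prod hu)
  refine lintegral_mono_ae ?_
  filter_upwards [h1] with t ht
  have hn : ((n : ℝ) + 1)⁻¹ ≠ 0 := by positivity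
  have q1 : ∀ᵐ y ∂(volume : Measure ℝ), u (t, v * t + y) = u' (t, v * t + y) :=
    (quasiMeasurePreserving_add_left volume (v * t)).ae ht
  have q2 := ENNReal.ae_le_essSup (μ := volume.restrict (J n))
    (fun y : ℝ => ‖u (t, v * t + y) - w t‖ₑ)
  rw [ae_restrict_iff' (hJ n)] at q2
  have q3 := (Measure.quasiMeasurePreserving_smul volume hn).ae (q1.and q2)
  calc ∫⁻ y in I, ‖u' (t, v * t + y / (n + 1)) - w t‖ₑ
      ≤ ∫⁻ y in I, essSup (fun y : ℝ => ‖u (t, v * t + y) - w t‖ₑ) (volume.restrict (J n)) := by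
        refine lintegral_mono_ae ?_
        filter_upwards [ae_restrict_of_ae q3, ae_restrict_mem hI] with y hy hyI
        have hdiv : ((n : ℝ) + 1)⁻¹ • y = y / (n + 1) := by rw [smul_eq_mul]; field_simp
        rw [hdiv] at hy
        rw [← hy.1]
        exact hy.2 (hIJ n y hyI)
    _ ≤ _ := by
        rw [lintegral_const, Measure.restrict_apply_univ]
        exact mul_le_of_le_one_right zero_le hI1

/-- Traces of a function with values in a closed set have values in that set. -/
lemma ae_mem_of_scaled_trace {u' : ℝ × ℝ → State} {B : Set State} (hB : IsClosed B)
    (huB : ∀ p, u' p ∈ B) {v b : ℝ} {w : ℝ → State}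
    (hw : AEStronglyMeasurable w (volume.restrict (Ioo 0 b))) {I : Set ℝ} (hI1 : volume I = 1)
    (h : Tendsto (fun n : ℕ => ∫⁻ t in Ioo 0 b, ∫⁻ y in I, ‖u' (t, v * t + y / (n + 1)) - w t‖ₑ)
      atTop (𝓝 0)) : ∀ᵐ t ∂(volume.restrict (Ioo 0 b)), w t ∈ B := by
  have hle : ∀ n : ℕ, ∫⁻ t in Ioo 0 b, Metric.infEDist (w t) B
      ≤ ∫⁻ t in Ioo 0 b, ∫⁻ y in I, ‖u' (t, v * t + y / (n + 1)) - w t‖ₑ := by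
    intro n
    refine lintegral_mono fun t => ?_
    calc Metric.infEDist (w t) B = ∫⁻ y in I, Metric.infEDist (w t) B := by
          rw [lintegral_const, Measure.restrict_apply_univ, hI1, mul_one]
      _ ≤ _ := lintegral_mono fun y => by
          rw [← edist_eq_enorm_sub, edist_comm]
          exact Metric.infEDist_le_edist_of_mem (huB _)
  have h0 : ∫⁻ t in Ioo 0 b, Metric.infEDist (w t) B = 0 :=
    le_antisymm (ge_of_tendsto' h hle) zero_le
  have hm : AEMeasurable (fun t => Metric.infEDist (w t) B) (volume.restrict (Ioo 0 b)) :=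
    Metric.continuous_infEDist.measurable.comp_aemeasurable hw.aemeasurable
  filter_upwards [(lintegral_eq_zero_iff' hm).1 h0] with t ht
  exact (Metric.mem_iff_infEDist_zero_of_closed hB).2 ht

lemma tendsto_scaled_trace_comp {u' : ℝ × ℝ → State} {B : Set State} (huB : ∀ p, u' p ∈ B)
    {F : State → ℝ} {L : NNReal} (hF : LipschitzOnWith L F B) {v b : ℝ} {w : ℝ → State}
    {I : Set ℝ} (hwB : ∀ᵐ t ∂(volume.restrict (Ioo 0 b)), w t ∈ B)
    (h : Tendsto (fun n : ℕ => ∫⁻ t in Ioo 0 b, ∫⁻ y in I, ‖u' (t, v * t + y / (n + 1)) - w t‖ₑ)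
      atTop (𝓝 0)) :
    Tendsto (fun n : ℕ => ∫⁻ t in Ioo 0 b, ∫⁻ y in I,
      ‖F (u' (t, v * t + y / (n + 1))) - F (w t)‖ₑ) atTop (𝓝 0) := by
  have hL := ENNReal.Tendsto.const_mul (a := (L : ℝ≥0∞)) h (Or.inr ENNReal.coe_ne_top)
  rw [mul_zero] at hL
  refine tendsto_of_tendsto_of_tendsto_of_le_of_le tendsto_const_nhds hL
    (fun _ => zero_le) fun n => ?_
  simp only
  rw [← lintegral_const_mul' _ _ ENNReal.coe_ne_top]
  refine lintegral_mono_ae ?_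
  filter_upwards [hwB] with t ht
  rw [← lintegral_const_mul' _ _ ENNReal.coe_ne_top]
  refine lintegral_mono fun y => ?_
  rw [← edist_eq_enorm_sub, ← edist_eq_enorm_sub]
  exact hF (huB _) ht

/-- The relative entropy and relative entropy flux with respect to a constant state form an
entropy pair: they differ from `(η, q)` by a constant and by a linear function of the conserved
quantity. -/
lemma relative_entropic {T : EReal} {f : State → State} {η q : State → ℝ} {u : ℝ × ℝ → State}
    {B : Set State} {φ : ℝ × ℝ → ℝ} (hφ : IsTest T φ) (hB : IsCompact B) (hu : Measurable u)
    (huB : ∀ p, u p ∈ B) (hf : ContinuousOn f B) (hη : ContinuousOn η B) (hq : ContinuousOn q B)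
    (hweak : ∫ p in strip T, (dt φ p • u p + dx φ p • f (u p)) = 0) (b : State) :
    ∫ p in strip T, (dt φ p * relEntropy η (u p) b + dx φ p * relFlux f η q (u p) b)
      = ∫ p in strip T, (dt φ p * η (u p) + dx φ p * q (u p)) := by
  set l := fderiv ℝ η b with hl
  obtain ⟨M₁, hM₁⟩ := hB.exists_bound_of_continuousOn hη
  obtain ⟨M₂, hM₂⟩ := hB.exists_bound_of_continuousOn hq
  obtain ⟨M₃, hM₃⟩ := hB.exists_bound_of_continuousOn hf
  obtain ⟨M₄, hM₄⟩ := hB.exists_bound_of_continuousOn (continuousOn_id (s := B))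
  have i1 : Integrable (fun p => dt φ p * η (u p) + dx φ p * q (u p)) :=
    hφ.integrable_pairing (M := max M₁ M₂) (measurable_comp_of_continuousOn hη hu huB)
      (measurable_comp_of_continuousOn hq hu huB)
      (fun p => (hM₁ _ (huB p)).trans (le_max_left _ _))
      (fun p => (hM₂ _ (huB p)).trans (le_max_right _ _))
  have i2 : Integrable (fun p => dt φ p • u p + dx φ p • f (u p)) := by
    refine Integrable.add ?_ ?_
    · refine (hφ.integrable_dt.norm.mul_const M₄).mono'
        (hφ.integrable_dt.aestronglyMeasurable.smul hu.aestronglyMeasurable)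
        (Eventually.of_forall fun p => ?_)
      rw [norm_smul]
      exact mul_le_mul_of_nonneg_left (hM₄ _ (huB p)) (norm_nonneg _)
    · refine (hφ.integrable_dx.norm.mul_const M₃).mono'
        (hφ.integrable_dx.aestronglyMeasurable.smul
          (measurable_comp_of_continuousOn hf hu huB).aestronglyMeasurable)
        (Eventually.of_forall fun p => ?_)
      rw [norm_smul]
      exact mul_le_mul_of_nonneg_left (hM₃ _ (huB p)) (norm_nonneg _)
  have i3 := hφ.integrable_dt
  have i4 := hφ.integrable_dx
  have i5 : Integrable (fun p => l (dt φ p • u p + dx φ p • f (u p))) := l.integrable_comp i2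
  have hlin : ∫ p in strip T, l (dt φ p • u p + dx φ p • f (u p)) = 0 := by
    rw [l.integral_comp_comm i2.integrableOn, hweak, map_zero]
  have hexp : ∀ p, dt φ p * relEntropy η (u p) b + dx φ p * relFlux f η q (u p) b
      = (dt φ p * η (u p) + dx φ p * q (u p)) - l (dt φ p • u p + dx φ p • f (u p))
        + (dt φ p * (l b - η b) + dx φ p * (l (f b) - q b)) := by
    intro p
    simp only [relEntropy, relFlux, map_sub, map_add, map_smul, smul_eq_mul, ← hl]
    ring
  simp_rw [hexp]
  have i6 : Integrable (fun p => dt φ p * η (u p) + dx φ p * q (u p)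
      - l (dt φ p • u p + dx φ p • f (u p))) := i1.sub i5
  have i7 : Integrable (fun p => dt φ p * (l b - η b) + dx φ p * (l (f b) - q b)) :=
    (i3.mul_const _).add (i4.mul_const _)
  rw [integral_add i6.integrableOn i7.integrableOn, integral_sub i1.integrableOn i5.integrableOn, hlin,
    integral_add (i3.mul_const _).integrableOn (i4.mul_const _).integrableOn, integral_mul_const,
    integral_mul_const, (integral_dt_dx_eq_zero hφ).1, (integral_dt_dx_eq_zero hφ).2]
  ring

lemma contDiffAt_relSpeedFlux {f : State → State} {η q : State → ℝ} {x : State}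
    (hf : ContDiffAt ℝ 1 f x) (hη : ContDiffAt ℝ 1 η x) (hq : ContDiffAt ℝ 1 q x) (v : ℝ)
    (b : State) : ContDiffAt ℝ 1 (relSpeedFlux f η q v b) x := by
  unfold relSpeedFlux relFlux relEntropy
  fun_prop

lemma abs_charSpeed_sub_le_sigmaBar (f : State → State) (i : Fin 2) (uL uR : State)
    (R : ℝ → State) (s₀ : ℝ) :
    |charSpeed f i uL - charSpeed f i uR| ≤ sigmaBar f i uL uR R s₀ := by
  unfold sigmaBar
  linarith [Real.iSup_nonneg (f := fun p : Ioi (0 : ℝ) × ℝ =>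
    ‖uL - rarefactionWave f i R s₀ p.1 p.2‖) fun p => norm_nonneg _]

end RareDissipation

open RareDissipation in
theorem mainTheorem9
    (f : RareDissipation.State → RareDissipation.State) (d : RareDissipation.State)
    (hGL : RareDissipation.SatisfiesGL f d)
    (W : Set RareDissipation.State) (hW : IsOpen W) (hdW : d ∈ W)
    (η q : RareDissipation.State → ℝ)
    (hη : RareDissipation.IsConvexEntropyPair f W η q) :
    ∃ K > 0, ∃ C₂ > 0, ∃ ε > 0,
      ∀ (T : EReal) (u : ℝ × ℝ → RareDissipation.State),
        RareDissipation.IsSmallEntropySolution f η q d ε T u →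
        ∃ m : MeasureTheory.Measure (ℝ × ℝ), RareDissipation.IsDissipationMeasure η q T u m ∧
          ∀ (i : Fin 2) (uL uR : RareDissipation.State) (s₀ : ℝ) (R : ℝ → RareDissipation.State),
            ‖uL - d‖ + ‖uR - d‖ ≤ ε → 0 < s₀ →
            RareDissipation.IsRarefactionCurve f i uL s₀ R → R s₀ = uR →
            ∀ a₁ a₂ : ℝ, 0 < a₁ → 0 < a₂ →
              RareDissipation.AdmissibleWeights i C₂ s₀ a₁ a₂ →
              ∀ v ∈ Set.uIcc (RareDissipation.charSpeed f i uL) (RareDissipation.charSpeed f i uR),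
              ∀ t : ℝ, 0 < t → (t : EReal) < T →
              ∀ uplus uminus : ℝ → RareDissipation.State,
                RareDissipation.IsRightTrace T u (fun τ => v * τ) uplus →
                RareDissipation.IsLeftTrace T u (fun τ => v * τ) uminus →
                ∫ τ in (0 : ℝ)..t,
                    (a₂ * (RareDissipation.relFlux f η q (uplus τ) uR
                          - v * RareDissipation.relEntropy η (uplus τ) uR)
                      - a₁ * (RareDissipation.relFlux f η q (uminus τ) uL
                          - v * RareDissipation.relEntropy η (uminus τ) uL))
                  ≤ a₂ * (K * RareDissipation.sigmaBar f i uL uR R s₀ ^ 2 * t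
                      + K * RareDissipation.sigmaBar f i uL uR R s₀
                        * m.real (RareDissipation.fan (RareDissipation.charSpeed f i uL)
                            (RareDissipation.charSpeed f i uR) t)) := by
  obtain ⟨C0, hC0, hK0⟩ := exists_pointwise_bound hGL hW hdW hη 0
  obtain ⟨C1, hC1, hK1⟩ := exists_pointwise_bound hGL hW hdW hη 1
  obtain ⟨K0, hK0pos, hev0⟩ := hK0 (max C0 C1) (le_max_left _ _)
  obtain ⟨K1, hK1pos, hev1⟩ := hK1 (max C0 C1) (le_max_right _ _)
  have hregular : ∀ᶠ x in 𝓝 d, ContDiffAt ℝ 4 f x ∧ x ∈ W :=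
    Filter.Eventually.and ((contDiffAt_of_satisfiesGL hGL).eventually (by simp))
      (hW.mem_nhds hdW)
  obtain ⟨ρ, hρ, hball⟩ := Metric.eventually_nhds_iff_ball.1 hregular
  have hsmall : ∀ᶠ ε in 𝓝[>] (0 : ℝ), ε < ρ := nhdsWithin_le_nhds (gt_mem_nhds hρ)
  obtain ⟨ε, ⟨⟨hε0, hε1⟩, hερ⟩, hε⟩ :=
    (((hev0.and hev1).and hsmall).and self_mem_nhdsWithin).exists
  have hεpos : 0 < ε := hε
  set B : Set State := Metric.closedBall d ε with hBdef
  have hBc : IsCompact B := isCompact_closedBall d ε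
  have hBne : B.Nonempty := ⟨d, Metric.mem_closedBall_self hεpos.le⟩
  have hBρ : ∀ x ∈ B, x ∈ Metric.ball d ρ := fun x hx => Metric.closedBall_subset_ball hερ hx
  have cf : ∀ x ∈ B, ContDiffAt ℝ 1 f x := fun x hx => (hball x (hBρ x hx)).1.of_le (by norm_num)
  have cη : ∀ x ∈ B, ContDiffAt ℝ 1 η x := fun x hx => (hη.contDiffOn_entropy.contDiffAt
    (hW.mem_nhds (hball x (hBρ x hx)).2)).of_le (by norm_num)
  have cq : ∀ x ∈ B, ContDiffAt ℝ 1 q x := fun x hx => (hη.contDiffOn_flux.contDiffAt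
    (hW.mem_nhds (hball x (hBρ x hx)).2)).of_le (by norm_num)
  have hfc : ContinuousOn f B := fun x hx => (cf x hx).continuousAt.continuousWithinAt
  have hηc : ContinuousOn η B := fun x hx => (cη x hx).continuousAt.continuousWithinAt
  have hqc : ContinuousOn q B := fun x hx => (cq x hx).continuousAt.continuousWithinAt
  have hKpos : 0 < max K0 K1 := lt_max_of_lt_left hK0pos
  refine ⟨max K0 K1, hKpos, max C0 C1, lt_max_of_lt_left hC0, ε, hεpos, fun T u hu => ?_⟩
  -- a measurable representative with values in the closed ball
  obtain ⟨u', hu'm, hu'r, huu'⟩ := hu.measurable.aemeasurable.exists_ae_eq_range_subset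
    (hu.mem_ball.mono fun p hp => Metric.ball_subset_closedBall hp) hBne
  have hu'B : ∀ p, u' p ∈ B := fun p => hu'r (mem_range_self p)
  have hweak : ∀ φ, IsTest T φ → ∫ p in strip T, (dt φ p • u' p + dx φ p • f (u' p)) = 0 := by
    intro φ hφ
    rw [← hu.weak φ hφ]
    exact integral_congr_ae (huu'.mono fun p hp => by simp only [hp])
  have hentEq : ∀ φ : ℝ × ℝ → ℝ, ∫ p in strip T, (dt φ p * η (u p) + dx φ p * q (u p))
      = ∫ p in strip T, (dt φ p * η (u' p) + dx φ p * q (u' p)) := fun φ =>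
    integral_congr_ae (huu'.mono fun p hp => by simp only [hp])
  have hent : ∀ φ, IsTest T φ → (∀ p, 0 ≤ φ p) →
      0 ≤ ∫ p in strip T, (dt φ p * η (u' p) + dx φ p * q (u' p)) := by
    intro φ hφ hφ0
    rw [← hentEq]
    exact hu.entropic φ hφ hφ0
  obtain ⟨M₁, hM₁⟩ := hBc.exists_bound_of_continuousOn hηc
  obtain ⟨M₂, hM₂⟩ := hBc.exists_bound_of_continuousOn hqc
  obtain ⟨m, hmlf, hm0, hmtest⟩ := exists_dissipation_measure (M := max M₁ M₂)
    (measurable_comp_of_continuousOn hηc hu'm hu'B)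
    (measurable_comp_of_continuousOn hqc hu'm hu'B)
    (fun p => (hM₁ _ (hu'B p)).trans (le_max_left _ _))
    (fun p => (hM₂ _ (hu'B p)).trans (le_max_right _ _)) hent
  refine ⟨m, ⟨hmlf, hm0, fun φ hφ => by rw [hmtest φ hφ, hentEq]⟩, ?_⟩
  intro i uL uR s₀ R hLR hs₀ hR hRs a₁ a₂ _ ha₂ haw v hv t ht htT up um hup hum
  have hIoo : Ioo 0 t ⊆ timeInterval T := Ioo_subset_timeInterval htT.le
  have hvol : volume (Ioo 0 t) ≠ ⊤ := by simp
  have upm : AEStronglyMeasurable up (volume.restrict (Ioo 0 t)) :=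
    hup.memLp.aestronglyMeasurable.mono_measure (Measure.restrict_mono_set volume hIoo)
  have umm : AEStronglyMeasurable um (volume.restrict (Ioo 0 t)) :=
    hum.memLp.aestronglyMeasurable.mono_measure (Measure.restrict_mono_set volume hIoo)
  have hp := tendsto_scaled_trace (I := Ioo (0 : ℝ) 1) huu' hIoo measurableSet_Ioo
    (by simp) (fun n => measurableSet_Ioo) (fun n y hy => by
      have : (0 : ℝ) < n + 1 := by positivity
      exact ⟨div_pos hy.1 this, by gcongr; exact hy.2⟩) (hup.tendsto t htT)
  have hm := tendsto_scaled_trace (I := Ioo (-1 : ℝ) 0) huu' hIoo measurableSet_Ioo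
    (by simp) (fun n => measurableSet_Ioo) (fun n y hy => by
      have : (0 : ℝ) < n + 1 := by positivity
      refine ⟨?_, div_neg_of_neg_of_pos hy.2 this⟩
      rw [← neg_div]; gcongr; exact hy.1) (hum.tendsto t htT)
  have upB := ae_mem_of_scaled_trace hBc.isClosed hu'B upm (by simp) hp
  have umB := ae_mem_of_scaled_trace hBc.isClosed hu'B umm (by simp) hm
  have hFR : ∀ x ∈ B, ContDiffAt ℝ 1 (relSpeedFlux f η q v uR) x := fun x hx =>
    contDiffAt_relSpeedFlux (cf x hx) (cη x hx) (cq x hx) v uR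
  have hFL : ∀ x ∈ B, ContDiffAt ℝ 1 (relSpeedFlux f η q v uL) x := fun x hx =>
    contDiffAt_relSpeedFlux (cf x hx) (cη x hx) (cq x hx) v uL
  have hFRc : ContinuousOn (relSpeedFlux f η q v uR) B := fun x hx =>
    (hFR x hx).continuousAt.continuousWithinAt
  have hFLc : ContinuousOn (relSpeedFlux f η q v uL) B := fun x hx =>
    (hFL x hx).continuousAt.continuousWithinAt
  obtain ⟨Lip, hLip⟩ := exists_lipschitzOnWith_of_contDiffAt hBc hFR
  have iRp := integrableOn_comp_of_continuousOn hBc hBne hFRc hvol upm upB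
  have iRm := integrableOn_comp_of_continuousOn hBc hBne hFRc hvol umm umB
  have iLm := integrableOn_comp_of_continuousOn hBc hBne hFLc hvol umm umB
  have haR : ContinuousOn (fun x => relEntropy η x uR) B := by
    unfold relEntropy; fun_prop
  have hcR : ContinuousOn (fun x => relFlux f η q x uR) B := by
    unfold relFlux; fun_prop
  obtain ⟨M₃, hM₃⟩ := hBc.exists_bound_of_continuousOn haR
  obtain ⟨M₄, hM₄⟩ := hBc.exists_bound_of_continuousOn hcR
  -- across the line, the relative flux with respect to `u_R` does not increase
  have htrace : ∫ τ in Ioo 0 t, relSpeedFlux f η q v uR (up τ)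
      ≤ ∫ τ in Ioo 0 t, relSpeedFlux f η q v uR (um τ) :=
    flux_trace_le (M := max M₃ M₄) (v := v)
      (measurable_comp_of_continuousOn haR hu'm hu'B)
      (measurable_comp_of_continuousOn hcR hu'm hu'B)
      (fun p => (hM₃ _ (hu'B p)).trans (le_max_left _ _))
      (fun p => (hM₄ _ (hu'B p)).trans (le_max_right _ _))
      (fun φ hφ hφ0 => by
        rw [relative_entropic hφ hBc hu'm hu'B hfc hηc hqc (hweak φ hφ) uR]
        exact hent φ hφ hφ0)
      hIoo iRp iRm (tendsto_scaled_trace_comp hu'B hLip upB hp)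
      (tendsto_scaled_trace_comp hu'B hLip umB hm)
  have hpoint : ∀ w ∈ B, relSpeedFlux f η q v uR w - a₁ / a₂ * relSpeedFlux f η q v uL w
      ≤ max K0 K1 * (charSpeed f i uL - charSpeed f i uR) ^ 2 := by
    intro w hw
    fin_cases i
    · exact (hε0 uL uR s₀ R hLR hs₀ hR hRs a₁ a₂ haw v hv w hw).trans
        (mul_le_mul_of_nonneg_right (le_max_left _ _) (sq_nonneg _))
    · exact (hε1 uL uR s₀ R hLR hs₀ hR hRs a₁ a₂ haw v hv w hw).trans
        (mul_le_mul_of_nonneg_right (le_max_right _ _) (sq_nonneg _))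
  set σ := sigmaBar f i uL uR R s₀ with hσ
  have hΔσ := abs_charSpeed_sub_le_sigmaBar f i uL uR R s₀
  have hσ0 : 0 ≤ σ := (abs_nonneg _).trans hΔσ
  have hΔsq : (charSpeed f i uL - charSpeed f i uR) ^ 2 ≤ σ ^ 2 := by
    rw [← sq_abs]; exact pow_le_pow_left₀ (abs_nonneg _) hΔσ 2
  have hmain : ∫ τ in Ioo 0 t, (relSpeedFlux f η q v uR (um τ)
      - a₁ / a₂ * relSpeedFlux f η q v uL (um τ)) ≤ max K0 K1 * σ ^ 2 * t := by
    have hconst : ∫ _ in Ioo 0 t, max K0 K1 * σ ^ 2 = max K0 K1 * σ ^ 2 * t := by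
      rw [setIntegral_const, Real.volume_real_Ioo_of_le ht.le, smul_eq_mul, sub_zero, mul_comm]
    rw [← hconst]
    refine integral_mono_ae (iRm.sub (iLm.const_mul _)) (integrableOn_const hvol) ?_
    filter_upwards [umB] with τ hτ
    exact (hpoint _ hτ).trans (mul_le_mul_of_nonneg_left hΔsq hKpos.le)
  rw [integral_sub iRm (iLm.const_mul _), integral_const_mul] at hmain
  rw [intervalIntegral.integral_of_le ht.le, integral_Ioc_eq_integral_Ioo]
  change ∫ τ in Ioo 0 t, (a₂ * relSpeedFlux f η q v uR (up τ)
    - a₁ * relSpeedFlux f η q v uL (um τ)) ≤ _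
  rw [integral_sub (iRp.const_mul _) (iLm.const_mul _), integral_const_mul, integral_const_mul]
  -- the pointwise estimate leaves no term to be absorbed by the dissipation in the fan: that term
  -- of the bound only has to be nonnegative
  have hmeas : 0 ≤ max K0 K1 * σ * m.real (fan (charSpeed f i uL) (charSpeed f i uR) t) :=
    mul_nonneg (mul_nonneg hKpos.le hσ0) measureReal_nonneg
  calc _ ≤ a₂ * ((∫ τ in Ioo 0 t, relSpeedFlux f η q v uR (um τ))
        - a₁ / a₂ * ∫ τ in Ioo 0 t, relSpeedFlux f η q v uL (um τ)) := by
        rw [mul_sub, ← mul_assoc, mul_div_cancel₀ _ ha₂.ne']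
        have := mul_le_mul_of_nonneg_left htrace ha₂.le
        linarith
    _ ≤ _ := mul_le_mul_of_nonneg_left (by linarith) ha₂.le
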